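/- Let $k,d\ge 1$. Let $V$ be the set of finite words over $\{1,\dots,k\}$, i.e. the vertices of the semi-infinite Cayley tree $\Gamma^k_+$ of order $k$: the root $o$ is the empty word and the direct successors of $x$ are $S(x)=\{(x,1),\dots,(x,k)\}$. Write $|x|$ for the length of $x$, $W_n=\{x:|x|=n\}$, $\Lambda_n=\{x:|x|\le n\}$, $\Lambda_{-1}=\emptyset$. For finite $\Lambda\subset V$ let $\mathcal A_\Lambda=\bigotimes_{x\in\Lambda}M_d(\mathbb C)$ (with $\mathcal A_\emptyset=\mathbb C$ and $\mathcal A_\Lambda\subseteq\mathcal A_{\Lambda'}$ via $a\mapsto a\otimes 1$ for $\Lambda\subseteq\Lambda'$), and let $\mathcal A_V$ be the C*-algebra completion of $\bigcup_n\mathcal A_{\Lambda_n}$. For $g\in V$ let $\alpha_g$ be the $*$-endomorphism of $\mathcal A_V$ that moves the tensor factor at each site $x$ to the site $(g,x)$ and puts $1$ at all sites not of this form. A state $\varphi$ on $\mathcal A_V$ is a *quantum Markov state with localized transition expectations* if there are a state $\phi_o$ on $\mathcal A_{\Lambda_0}$, positive elements $h_n\in\mathcal A_{\Lambda_n}$,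 and completely positive unital maps $E_{\Lambda_n}:\mathcal A_{\Lambda_{n+1}}\to\mathcal A_{\Lambda_n}$ with $E_{\Lambda_n}(ca)=cE_{\Lambda_n}(a)$ for $c\in\mathcal A_{\Lambda_{n-1}}$, such that 1. $\varphi(a)=\lim_{n\to\infty}\phi_o\circ E_{\Lambda_0}\circ\cdots\circ E_{\Lambda_n}\bigl(h_{n+1}^{1/2}\,a\,h_{n+1}^{1/2}\bigr)$ for every $a\in\bigcup_m\mathcal A_{\Lambda_m}$; 2. $\varphi(E_{\Lambda_n}(a))=\varphi(a)$ for all $n\ge 0$ and $a\in\mathcal A_{\Lambda_{n+1}}$; 3. there are completely positive unital maps $\mathcal E_x:\mathcal A_{\{x\}\cup S(x)}\to\mathcal A_{\{x\}}$ $(x\in V)$ with $E_{\Lambda_n}=\mathrm{id}_{\mathcal A_{\Lambda_{n-1}}}\otimes\bigotimes_{x\in W_n}\mathcal E_x$ for all $n\ge0$. **Theorem.** Let $\varphi$ be a quantum Markov state on $\mathcal A_V$ with localized transition expectations. Assume that $\varphi$ is faithful ($\varphi(a^*a)=0$ implies $a=0$, for $a\in\mathcal A_V$) and translation-invariant ($\varphi\circ\alpha_j=\varphi$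 for $j=1,\dots,k$). Then $\varphi$ is strongly mixing: for all $a,b\in\mathcal A_V$, $$\lim_{|g|\to\infty}\varphi(a\,\alpha_g(b))=\varphi(a)\varphi(b).$$ -/

import Mathlib

open scoped ComplexOrder CStarAlgebra InnerProductSpace

namespace TreeQMS

noncomputable section

/-- The Hilbert space `ℓ²(X)`. -/
abbrev Ell2 (X : Type*) : Type _ := lp (fun _ : X => ℂ) 2

section Ampliation

variable {U V ι : Type*}

theorem summable_sq {X : Type*} (ψ : Ell2 X) : Summable fun x => ‖ψ x‖ ^ 2 := by
  have h := (lp.memℓp ψ).summable (by norm_num)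
  simpa using h

theorem tsum_sq {X : Type*} (ψ : Ell2 X) : ∑' x, ‖ψ x‖ ^ 2 = ‖ψ‖ ^ 2 := by
  have h := lp.norm_rpow_eq_tsum (p := 2) (by norm_num) ψ
  simpa using h.symm

theorem memℓp_of_summable_sq {X : Type*} {ψ : X → ℂ} (h : Summable fun x => ‖ψ x‖ ^ 2) :
    Memℓp ψ 2 :=
  memℓp_gen (by simpa using h)

/-- The part of `ψ` on the configurations that agree with `σ` outside the range of `f`. -/
def slice (f : U ↪ V) (σ : V → ι) (ψ : Ell2 (V → ι)) : Ell2 (U → ι) :=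
  ⟨fun η => ψ (Function.extend f η σ), memℓp_of_summable_sq <|
    (summable_sq ψ).comp_injective (Function.extend_injective f.injective σ)⟩

@[simp]
theorem slice_apply (f : U ↪ V) (σ : V → ι) (ψ : Ell2 (V → ι)) (η : U → ι) :
    slice f σ ψ η = ψ (Function.extend f η σ) := rfl

open Classical in
/-- A configuration is determined by its values on the range of `f` and off it. -/
def splitEquiv (f : U ↪ V) (ι : Type*) :
    (V → ι) ≃ ({v // v ∉ Set.range f} → ι) × (U → ι) where
  toFun σ := (fun v => σ v, σ ∘ f)
  invFun p v := if h : v ∈ Set.range f then p.2 h.choose else p.1 ⟨v, h⟩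
  left_inv σ := by
    funext v
    by_cases h : v ∈ Set.range f
    · simp only [h, dif_pos, Function.comp]
      exact congrArg σ h.choose_spec
    · simp only [h, dif_neg, not_false_eq_true]
  right_inv p := by
    refine Prod.ext ?_ ?_
    · funext v
      simp only [v.2, dif_neg, not_false_eq_true]
    · funext u
      have h : f u ∈ Set.range f := ⟨u, rfl⟩
      simp only [Function.comp, h, dif_pos]
      exact congrArg p.2 (f.injective h.choose_spec)

theorem splitEquiv_symm_comp (f : U ↪ V) (p : ({v // v ∉ Set.range f} → ι) × (U → ι)) :
    (splitEquiv f ι).symm p ∘ f = p.2 :=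
  congrArg Prod.snd ((splitEquiv f ι).apply_symm_apply p)

theorem extend_splitEquiv_symm (f : U ↪ V) (b : {v // v ∉ Set.range f} → ι) (η η' : U → ι) :
    Function.extend f η' ((splitEquiv f ι).symm (b, η)) = (splitEquiv f ι).symm (b, η') := by
  funext v
  by_cases h : v ∈ Set.range f
  · obtain ⟨u, rfl⟩ := h
    rw [f.injective.extend_apply]
    exact (congrFun (splitEquiv_symm_comp f (b, η')) u).symm
  · rw [Function.extend_apply' _ _ _ (by simpa using h)]
    simp only [splitEquiv, Equiv.coe_fn_symm_mk, h, dif_neg, not_false_eq_true]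

/-- The part of `ψ` with values `b` off the range of `f`. -/
def slice' (f : U ↪ V) (b : {v // v ∉ Set.range f} → ι) (ψ : Ell2 (V → ι)) : Ell2 (U → ι) :=
  ⟨fun η => ψ ((splitEquiv f ι).symm (b, η)), memℓp_of_summable_sq <|
    (summable_sq ψ).comp_injective fun η η' h => by simpa using h⟩

theorem slice_splitEquiv_symm (f : U ↪ V) (p : ({v // v ∉ Set.range f} → ι) × (U → ι))
    (ψ : Ell2 (V → ι)) : slice f ((splitEquiv f ι).symm p) ψ = slice' f p.1 ψ := by
  ext η
  exact congrArg ψ (extend_splitEquiv_symm f p.1 p.2 η)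

theorem hasSum_slice' (f : U ↪ V) (ψ : Ell2 (V → ι)) :
    HasSum (fun b => ‖slice' f b ψ‖ ^ 2) (‖ψ‖ ^ 2) := by
  have h0 : HasSum (fun σ => ‖ψ σ‖ ^ 2) (‖ψ‖ ^ 2) := tsum_sq ψ ▸ (summable_sq ψ).hasSum
  have h : HasSum (fun p => ‖ψ ((splitEquiv f ι).symm p)‖ ^ 2) (‖ψ‖ ^ 2) :=
    ((splitEquiv f ι).symm.hasSum_iff (f := fun σ => ‖ψ σ‖ ^ 2)).2 h0
  refine h.prod_fiberwise fun b => ?_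
  have hb := (summable_sq (slice' f b ψ)).hasSum
  rw [tsum_sq] at hb
  exact hb

theorem amp_summable (f : U ↪ V) (T : Ell2 (U → ι) →L[ℂ] Ell2 (U → ι)) (ψ : Ell2 (V → ι)) :
    Summable (fun p : ({v // v ∉ Set.range f} → ι) × (U → ι) => ‖T (slice' f p.1 ψ) p.2‖ ^ 2) ∧
    ∑' p : ({v // v ∉ Set.range f} → ι) × (U → ι), ‖T (slice' f p.1 ψ) p.2‖ ^ 2
      ≤ (‖T‖ * ‖ψ‖) ^ 2 := by
  have hle : ∀ b, ‖T (slice' f b ψ)‖ ^ 2 ≤ ‖T‖ ^ 2 * ‖slice' f b ψ‖ ^ 2 := fun b => by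
    rw [← mul_pow]; gcongr; exact T.le_opNorm _
  have hs := (hasSum_slice' f ψ).mul_left (‖T‖ ^ 2)
  have hs' : Summable fun b => ‖T (slice' f b ψ)‖ ^ 2 :=
    hs.summable.of_nonneg_of_le (fun b => by positivity) hle
  have h : Summable (fun p : ({v // v ∉ Set.range f} → ι) × (U → ι) =>
      ‖T (slice' f p.1 ψ) p.2‖ ^ 2) := by
    refine (summable_prod_of_nonneg fun p => by positivity).2
      ⟨fun b => summable_sq (T (slice' f b ψ)), ?_⟩
    exact hs'.congr fun b => (tsum_sq (T (slice' f b ψ))).symm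
  refine ⟨h, ?_⟩
  rw [h.tsum_prod, mul_pow, ← hs.tsum_eq, tsum_congr fun b => tsum_sq (T (slice' f b ψ))]
  exact hs'.tsum_le_tsum hle hs.summable

theorem amp_summable' (f : U ↪ V) (T : Ell2 (U → ι) →L[ℂ] Ell2 (U → ι)) (ψ : Ell2 (V → ι)) :
    Summable (fun σ : V → ι => ‖T (slice f σ ψ) (σ ∘ f)‖ ^ 2) := by
  rw [← (splitEquiv f ι).symm.summable_iff]
  refine (amp_summable f T ψ).1.congr fun p => ?_
  simp only [Function.comp_apply, slice_splitEquiv_symm, splitEquiv_symm_comp]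

/-- The operator `T ⊗ 1` on `ℓ²(V → ι)`, where `T` acts on the coordinates in the range of `f`. -/
def amp (f : U ↪ V) (T : Ell2 (U → ι) →L[ℂ] Ell2 (U → ι)) : Ell2 (V → ι) →L[ℂ] Ell2 (V → ι) :=
  LinearMap.mkContinuous
    { toFun ψ := ⟨fun σ => T (slice f σ ψ) (σ ∘ f), memℓp_of_summable_sq (amp_summable' f T ψ)⟩
      map_add' ψ χ := by
        ext σ
        have : slice f σ (ψ + χ) = slice f σ ψ + slice f σ χ := rfl
        change T (slice f σ (ψ + χ)) (σ ∘ f) = _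
        rw [this, map_add]
        rfl
      map_smul' c ψ := by
        ext σ
        have : slice f σ (c • ψ) = c • slice f σ ψ := rfl
        change T (slice f σ (c • ψ)) (σ ∘ f) = _
        rw [this, map_smul]
        rfl }
    ‖T‖ fun ψ => by
      refine le_of_sq_le_sq ?_ (by positivity)
      rw [← tsum_sq, ← (splitEquiv f ι).symm.tsum_eq]
      simpa only [LinearMap.coe_mk, AddHom.coe_mk, slice_splitEquiv_symm,
        splitEquiv_symm_comp] using (amp_summable f T ψ).2

theorem amp_apply (f : U ↪ V) (T : Ell2 (U → ι) →L[ℂ] Ell2 (U → ι)) (ψ : Ell2 (V → ι))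
    (σ : V → ι) : amp f T ψ σ = T (slice f σ ψ) (σ ∘ f) := rfl

theorem slice_amp (f : U ↪ V) (T : Ell2 (U → ι) →L[ℂ] Ell2 (U → ι)) (ψ : Ell2 (V → ι))
    (σ : V → ι) : slice f σ (amp f T ψ) = T (slice f σ ψ) := by
  ext η
  have h : slice f (Function.extend f η σ) ψ = slice f σ ψ := by
    ext η'
    refine congrArg ψ (funext fun v => ?_)
    by_cases hv : ∃ u, f u = v
    · obtain ⟨u, rfl⟩ := hv
      rw [f.injective.extend_apply, f.injective.extend_apply]
    · rw [Function.extend_apply' _ _ _ hv, Function.extend_apply' _ _ _ hv,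
        Function.extend_apply' _ _ _ hv]
  rw [slice_apply, amp_apply, h, show Function.extend f η σ ∘ f = η from
    funext fun u => f.injective.extend_apply η σ u]

theorem inner_amp (f : U ↪ V) (T S : Ell2 (U → ι) →L[ℂ] Ell2 (U → ι)) (ψ χ : Ell2 (V → ι))
    (h : ∀ ψ' χ' : Ell2 (U → ι), ⟪T ψ', χ'⟫_ℂ = ⟪ψ', S χ'⟫_ℂ) :
    ⟪amp f T ψ, χ⟫_ℂ = ⟪ψ, amp f S χ⟫_ℂ := by
  have key : ∀ ψ χ : Ell2 (V → ι), ⟪ψ, χ⟫_ℂ =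
      ∑' b : {v // v ∉ Set.range f} → ι, ⟪slice' f b ψ, slice' f b χ⟫_ℂ := by
    intro ψ χ
    have hs : Summable fun p => ⟪ψ ((splitEquiv f ι).symm p), χ ((splitEquiv f ι).symm p)⟫_ℂ :=
      (lp.summable_inner (𝕜 := ℂ) ψ χ).comp_injective (splitEquiv f ι).symm.injective
    rw [lp.inner_eq_tsum,
      ← (splitEquiv f ι).symm.tsum_eq fun σ => ⟪ψ σ, χ σ⟫_ℂ, hs.tsum_prod]
    exact tsum_congr fun b => (lp.inner_eq_tsum (slice' f b ψ) (slice' f b χ)).symm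
  have key2 : ∀ (T : Ell2 (U → ι) →L[ℂ] Ell2 (U → ι)) (ψ : Ell2 (V → ι))
      (b : {v // v ∉ Set.range f} → ι), slice' f b (amp f T ψ) = T (slice' f b ψ) := by
    intro T ψ b
    ext η
    have := slice_amp f T ψ ((splitEquiv f ι).symm (b, η))
    rw [slice_splitEquiv_symm, slice_splitEquiv_symm] at this
    rw [this]
  rw [key, key]
  refine tsum_congr fun b => ?_
  rw [key2, key2, h]

/-- `T ↦ T ⊗ 1` as a unital `*`-homomorphism. -/
def ampHom (f : U ↪ V) (ι : Type*) :
    (Ell2 (U → ι) →L[ℂ] Ell2 (U → ι)) →⋆ₐ[ℂ] (Ell2 (V → ι) →L[ℂ] Ell2 (V → ι)) where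
  toFun T := amp f T
  map_one' := by
    ext ψ σ
    exact congrArg ψ (funext fun v => by
      by_cases hv : ∃ u, f u = v
      · obtain ⟨u, rfl⟩ := hv
        rw [f.injective.extend_apply]; rfl
      · rw [Function.extend_apply' _ _ _ hv])
  map_mul' T S := by
    ext ψ σ
    rw [mul_apply_eq_comp, amp_apply, amp_apply, slice_amp]
    rfl
  map_zero' := by ext ψ σ; rfl
  map_add' T S := by ext ψ σ; rfl
  commutes' c := by
    ext ψ σ
    refine congrArg (c * ·) (congrArg ψ (funext fun v => ?_))
    by_cases hv : ∃ u, f u = v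
    · obtain ⟨u, rfl⟩ := hv
      rw [f.injective.extend_apply]; rfl
    · rw [Function.extend_apply' _ _ _ hv]
  map_star' T := by
    rw [ContinuousLinearMap.star_eq_adjoint, ContinuousLinearMap.star_eq_adjoint,
      ContinuousLinearMap.eq_adjoint_iff]
    exact fun ψ χ => inner_amp f _ _ ψ χ fun ψ' χ' => ContinuousLinearMap.adjoint_inner_left _ _ _

theorem ampHom_apply (f : U ↪ V) (T : Ell2 (U → ι) →L[ℂ] Ell2 (U → ι)) (ψ : Ell2 (V → ι))
    (σ : V → ι) : ampHom f ι T ψ σ = T (slice f σ ψ) (σ ∘ f) := rfl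

theorem ampHom_trans {W : Type*} (f : U ↪ V) (g : V ↪ W)
    (T : Ell2 (U → ι) →L[ℂ] Ell2 (U → ι)) :
    ampHom (f.trans g) ι T = ampHom g ι (ampHom f ι T) := by
  ext ψ σ
  rw [ampHom_apply, ampHom_apply, ampHom_apply]
  have h : slice (f.trans g) σ ψ = slice f (σ ∘ g) (slice g σ ψ) := by
    ext η
    exact congrArg ψ (f.injective.extend_comp g.injective η σ)
  rw [h]
  rfl

/-- Matrices as operators on `ℓ²` of a finite set. -/
def matOp (X : Type*) [Fintype X] [DecidableEq X] :
    CStarMatrix X X ℂ ≃⋆ₐ[ℂ] (Ell2 X →L[ℂ] Ell2 X) :=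
  (CStarMatrix.ofMatrixStarAlgEquiv.symm.trans Matrix.toEuclideanCLM).trans
    (lpPiLpₗᵢ (fun _ : X => ℂ) ℂ).symm.conjStarAlgEquiv

theorem matOp_apply (X : Type*) [Fintype X] [DecidableEq X] (a : CStarMatrix X X ℂ)
    (ψ : Ell2 X) (x : X) : matOp X a ψ x = ∑ y, a x y * ψ y := rfl

end Ampliation

section Tree

/-- The vertices of the semi-infinite Cayley tree of order `k`, in coordinates: the root is `[]` and
the direct successors of `x` are the `x ++ [i]`. The level of `x` is its length. -/
abbrev Vertex (k : ℕ) : Type := List (Fin k)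

variable {k : ℕ}

/-- The direct successors `S(x)`. -/
def succs (x : Vertex k) : Finset (Vertex k) := Finset.univ.image fun i => x ++ [i]

/-- The `n`-th level `W_n`. -/
def level (k : ℕ) : ℕ → Finset (Vertex k)
  | 0 => {[]}
  | n + 1 => (level k n).biUnion succs

/-- The vertices of level `< n`; this is `Λ_{n-1}` (empty if `n = 0`). -/
def below (k n : ℕ) : Finset (Vertex k) := (Finset.range n).biUnion (level k)

/-- `Λ_n`, the vertices of level `≤ n`. -/
abbrev ball (k n : ℕ) : Finset (Vertex k) := below k (n + 1)

theorem mem_level {n : ℕ} {x : Vertex k} : x ∈ level k n ↔ x.length = n := by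
  induction n generalizing x with
  | zero => simp [level]
  | succ n ih =>
    simp only [level, succs, Finset.mem_biUnion, Finset.mem_image, Finset.mem_univ, true_and]
    constructor
    · rintro ⟨y, hy, i, rfl⟩
      simp [ih.1 hy]
    · intro h
      have hx : x ≠ [] := by rintro rfl; simp at h
      exact ⟨x.dropLast, ih.2 (by simp [h]), x.getLast hx, List.dropLast_append_getLast hx⟩

theorem mem_below {n : ℕ} {x : Vertex k} : x ∈ below k n ↔ x.length < n := by
  simp [below, mem_level]

theorem below_mono {m n : ℕ} (h : m ≤ n) : below k m ⊆ below k n := fun _ hx =>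
  mem_below.2 ((mem_below.1 hx).trans_le h)

theorem star_subset_ball {n : ℕ} {x : Vertex k} (hx : x ∈ level k n) :
    insert x (succs x) ⊆ ball k (n + 1) := by
  intro y hy
  rw [mem_level] at hx
  rw [mem_below]
  simp only [succs, Finset.mem_insert, Finset.mem_image, Finset.mem_univ, true_and] at hy
  rcases hy with rfl | ⟨i, rfl⟩
  · omega
  · simp; omega

theorem singleton_subset_ball {n : ℕ} {x : Vertex k} (hx : x ∈ level k n) :
    {x} ⊆ ball k n := by
  rw [Finset.singleton_subset_iff, mem_below, mem_level.1 hx]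
  exact Nat.lt_succ_self n

/-- The shift `α_g : x ↦ (g, x)` of the tree. -/
def vertexShift (g : Vertex k) : Vertex k ↪ Vertex k := ⟨(g ++ ·), List.append_right_injective g⟩

end Tree

section LocalAlgebras

variable {k d : ℕ}

/-- The local algebra `𝒜_Λ = ⨂_{x ∈ Λ} M_d` of a finite set `Λ`: the matrices indexed by the
configurations `Λ → Fin d`, with the Kronecker product as tensor product. -/
abbrev Alg (d : ℕ) (Λ : Finset (Vertex k)) : Type := CStarMatrix (Λ → Fin d) (Λ → Fin d) ℂ

/-- The inclusion `a ↦ a ⊗ 1` of `𝒜_Λ` into `𝒜_Λ'`. -/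
def incl {Λ Λ' : Finset (Vertex k)} (h : Λ ⊆ Λ') (a : Alg d Λ) : Alg d Λ' :=
  CStarMatrix.ofMatrix fun σ τ =>
    if ∀ x : Λ', x.1 ∉ Λ → σ x = τ x then
      a (Finset.restrict₂ (π := fun _ => Fin d) h σ) (Finset.restrict₂ (π := fun _ => Fin d) h τ)
    else 0

/-- The tensor product `c ⊗ ⨂_{x ∈ W_n} a_x` in `𝒜_Λ`, where `Λ` is the disjoint union of `Λ_{n-1}`
and of the regions `R x`, `x ∈ W_n`. -/
def levelTensor (n : ℕ) {Λ : Finset (Vertex k)} {R : Vertex k → Finset (Vertex k)}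
    (hc : below k n ⊆ Λ) (hR : ∀ x ∈ level k n, R x ⊆ Λ)
    (c : Alg d (below k n)) (a : ∀ x, Alg d (R x)) : Alg d Λ :=
  CStarMatrix.ofMatrix fun σ τ =>
    c (Finset.restrict₂ (π := fun _ => Fin d) hc σ) (Finset.restrict₂ (π := fun _ => Fin d) hc τ) *
      ∏ x : level k n, a x (Finset.restrict₂ (π := fun _ => Fin d) (hR x x.2) σ)
        (Finset.restrict₂ (π := fun _ => Fin d) (hR x x.2) τ)

/-- `𝒜_Λ` acting on the coordinates in `Λ` of `ℓ²(V → Fin d)`. -/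
def locRep (Λ : Finset (Vertex k)) :
    Alg d Λ →⋆ₐ[ℂ] (Ell2 (Vertex k → Fin d) →L[ℂ] Ell2 (Vertex k → Fin d)) :=
  (ampHom (Function.Embedding.subtype (· ∈ Λ)) (Fin d)).comp
    (matOp (Λ → Fin d) : Alg d Λ →⋆ₐ[ℂ] (Ell2 (Λ → Fin d) →L[ℂ] Ell2 (Λ → Fin d)))

/-- The quasi-local algebra: the norm closure of the local algebra generated by the `𝒜_{Λ_n}`. -/
def quasiLocal (k d : ℕ) :
    StarSubalgebra ℂ (Ell2 (Vertex k → Fin d) →L[ℂ] Ell2 (Vertex k → Fin d)) :=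
  (⨆ n, (locRep (d := d) (ball k n)).range).topologicalClosure

/-- The quasi-local C*-algebra `𝒜_V`. -/
def AV (k d : ℕ) : Type := quasiLocal k d

instance : CStarAlgebra (AV k d) :=
  StarSubalgebra.cstarAlgebra (quasiLocal k d)
    (h_closed := StarSubalgebra.isClosed_topologicalClosure _)

/-- The inclusion of `𝒜_V` into the bounded operators on `ℓ²(V → Fin d)`. -/
def AV.toOp : AV k d →⋆ₐ[ℂ] (Ell2 (Vertex k → Fin d) →L[ℂ] Ell2 (Vertex k → Fin d)) :=
  (quasiLocal k d).subtype

theorem locRep_mem (n : ℕ) (a : Alg d (ball k n)) : locRep (ball k n) a ∈ quasiLocal k d :=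
  StarSubalgebra.le_topologicalClosure _
    ((le_iSup (fun n => (locRep (d := d) (ball k n)).range) n) ⟨a, rfl⟩)

/-- The embedding of `𝒜_{Λ_n}` into `𝒜_V`. -/
def toAV (n : ℕ) : Alg d (ball k n) →⋆ₐ[ℂ] AV k d :=
  (locRep (ball k n)).codRestrict (quasiLocal k d) (locRep_mem n)

theorem locRep_eq (Λ : Finset (Vertex k)) (a : Alg d Λ) :
    locRep Λ a = ampHom (Function.Embedding.subtype (· ∈ Λ)) (Fin d) (matOp (Λ → Fin d) a) := rfl

theorem locRep_apply (Λ : Finset (Vertex k)) (a : Alg d Λ) (ψ : Ell2 (Vertex k → Fin d))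
    (σ : Vertex k → Fin d) : locRep Λ a ψ σ = ∑ η : Λ → Fin d,
      a (fun x => σ x) η * ψ (Function.extend (Function.Embedding.subtype (· ∈ Λ)) η σ) := by
  rw [locRep_eq, ampHom_apply, matOp_apply]
  rfl

theorem ampHom_locRep {Λ Λ' : Finset (Vertex k)} (s : Vertex k ↪ Vertex k) (f : Λ ↪ Λ')
    (hf : ∀ x : Λ, s x = f x) (a : Alg d Λ) :
    ampHom s (Fin d) (locRep Λ a) =
      locRep Λ' ((matOp _).symm (ampHom f (Fin d) (matOp _ a))) := by
  have hf' : (Function.Embedding.subtype (· ∈ Λ)).trans s =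
      f.trans (Function.Embedding.subtype (· ∈ Λ')) := Function.Embedding.ext hf
  rw [locRep_eq, locRep_eq, StarAlgEquiv.apply_symm_apply, ← ampHom_trans, ← ampHom_trans, hf']

theorem locRep_incl {Λ Λ' : Finset (Vertex k)} (h : Λ ⊆ Λ') (a : Alg d Λ) :
    locRep Λ' (incl h a) = locRep Λ a := by
  ext ψ σ
  rw [locRep_apply, locRep_apply]
  let e : (Λ → Fin d) → (Λ' → Fin d) := fun η =>
    Function.extend (Set.inclusion h) η (fun y => σ y.1)
  have hinj : Function.Injective (Set.inclusion h : Λ → Λ') := Set.inclusion_injective h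
  symm
  refine Finset.sum_of_injOn e (Function.extend_injective hinj _).injOn (fun _ _ => by simp) ?_ ?_
  · intro τ _ hτ
    have : ¬ ∀ x : Λ', x.1 ∉ Λ → σ x = τ x := fun hx => hτ <| by
      refine ⟨fun y => τ (Set.inclusion h y), by simp, funext fun y => ?_⟩
      by_cases hy : y.1 ∈ Λ
      · exact hinj.extend_apply _ _ (⟨y.1, hy⟩ : Λ)
      · refine (Function.extend_apply' _ _ _ ?_).trans (hx y hy)
        rintro ⟨z, rfl⟩
        exact hy z.2
    have h0 : incl h a (fun y => σ y.1) τ = 0 := if_neg this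
    rw [h0, zero_mul]
  · intro η _
    have h1 : incl h a (fun y => σ y.1) (e η) = a (fun y => σ y.1) η := by
      have hη : (Finset.restrict₂ (π := fun _ => Fin d) h (e η) : Λ → Fin d) = η :=
        funext fun y => hinj.extend_apply η (fun y : Λ' => σ y.1) y
      refine (if_pos fun x hx => ?_).trans (by rw [hη]; rfl)
      refine (Function.extend_apply' η (fun y : Λ' => σ y.1) x ?_).symm
      rintro ⟨z, rfl⟩
      exact hx z.2
    have h2 : Function.extend (Function.Embedding.subtype (· ∈ Λ)) η σ =
        Function.extend (Function.Embedding.subtype (· ∈ Λ')) (e η) σ :=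
      Function.Injective.extend_comp hinj Subtype.val_injective η σ
    rw [h1, h2]

theorem toAV_incl {m n : ℕ} (h : m ≤ n) (a : Alg d (ball k m)) :
    toAV n (incl (below_mono (Nat.succ_le_succ h)) a) = toAV m a :=
  Subtype.ext (locRep_incl _ a)

theorem ampHom_shift_locRep_mem (g : Vertex k) (n : ℕ) (a : Alg d (ball k n)) :
    ampHom (vertexShift g) (Fin d) (locRep (ball k n) a) ∈ quasiLocal k d := by
  have hmem : ∀ x : ball k n, vertexShift g x ∈ ball k (g.length + n) := fun x => by
    have := mem_below.1 x.2
    rw [mem_below]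
    change (g ++ x.1).length < _
    rw [List.length_append]
    omega
  have e := ampHom_locRep (vertexShift g)
    (⟨fun x => ⟨vertexShift g x, hmem x⟩, fun x y h => Subtype.ext
      ((vertexShift g).injective (congrArg Subtype.val h))⟩ : ball k n ↪ ball k (g.length + n))
    (fun _ => rfl) a
  rw [e]
  exact locRep_mem _ _

theorem ampHom_shift_mem (g : Vertex k) {T : Ell2 (Vertex k → Fin d) →L[ℂ] Ell2 (Vertex k → Fin d)}
    (hT : T ∈ quasiLocal k d) : ampHom (vertexShift g) (Fin d) T ∈ quasiLocal k d := by
  have hcont : Continuous (ampHom (V := Vertex k) (vertexShift g) (Fin d)) := map_continuous _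
  have hle : quasiLocal k d ≤ (quasiLocal k d).comap (ampHom (vertexShift g) (Fin d)) := by
    refine StarSubalgebra.topologicalClosure_minimal (iSup_le fun n => ?_)
      ((StarSubalgebra.isClosed_topologicalClosure _).preimage hcont)
    intro S hS
    obtain ⟨a, ha⟩ := hS
    have ha' : locRep (ball k n) a = S := ha
    rw [StarSubalgebra.mem_comap, ← ha']
    exact ampHom_shift_locRep_mem g n a
  exact (StarSubalgebra.mem_comap _ _ _).1 (hle hT)

/-- The shift `α_g` of `𝒜_V`: it sends `⨂_x a_x` to the element with `a_x` at the site `(g, x)`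
and `1` at all sites that are not of this form. -/
def shift (g : Vertex k) : AV k d →⋆ₐ[ℂ] AV k d :=
  ((ampHom (vertexShift g) (Fin d)).comp AV.toOp).codRestrict (quasiLocal k d)
    fun a => ampHom_shift_mem g a.2

end LocalAlgebras

section States

open Filter Topology

/-- A state of a unital `*`-algebra: a positive normalized linear functional. -/
structure IsState {A : Type*} [Ring A] [StarRing A] [Algebra ℂ A] (φ : A →ₗ[ℂ] ℂ) : Prop where
  nonneg : ∀ a, 0 ≤ φ (star a * a)
  map_one : φ 1 = 1

variable {k d : ℕ}

/-- A family of completely positive maps `E_{Λ_n} : 𝒜_{Λ_{n+1}} → 𝒜_{Λ_n}`. -/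
abbrev CPFamily (k d : ℕ) : Type := ∀ n, Alg d (ball k (n + 1)) →CP Alg d (ball k n)

/-- The positive square root of a positive element of a C*-algebra. -/
def posSqrt {A : Type*} [CStarAlgebra A] [PartialOrder A] [StarOrderedRing A] (a : A) : A :=
  CFC.sqrt a

/-- `E` is a quasi-conditional expectation with respect to the triplet
`𝒜_{Λ_{n-1}} ⊆ 𝒜_{Λ_n} ⊆ 𝒜_{Λ_{n+1}}`. -/
structure IsQuasiConditionalExpectation (n : ℕ)
    (E : Alg d (ball k (n + 1)) →CP Alg d (ball k n)) : Prop where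
  map_one : E 1 = 1
  map_incl_mul : ∀ (c : Alg d (below k n)) (a : Alg d (ball k (n + 1))),
    E (incl (below_mono (Nat.le_add_right n 2)) c * a) =
      incl (below_mono (Nat.le_add_right n 1)) c * E a

/-- The composition `E_{Λ_0} ∘ ⋯ ∘ E_{Λ_{n-1}} : 𝒜_{Λ_n} → 𝒜_{Λ_0}`. -/
def compTo (E : CPFamily k d) : ∀ n, Alg d (ball k n) → Alg d (ball k 0)
  | 0, a => a
  | n + 1, a => compTo E n (E n a)

/-- `φ` is the quantum Markov chain with initial state `φo`, quasi-conditional expectations `E n`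
and boundary conditions `h n`. -/
structure IsQuantumMarkovChain (φo : Alg d (ball k 0) →ₗ[ℂ] ℂ) (E : CPFamily k d)
    (h : ∀ n, Alg d (ball k n)) (φ : AV k d →ₗ[ℂ] ℂ) : Prop where
  initial : IsState φo
  quasi : ∀ n, IsQuasiConditionalExpectation n (E n)
  boundary : ∀ n, 0 ≤ h n
  state : IsState φ
  tendsto : ∀ (m : ℕ) (a : Alg d (ball k m)),
    Tendsto (fun t => φo (compTo E (m + t)
        (posSqrt (h (m + t)) * incl (below_mono (by omega)) a * posSqrt (h (m + t)))))
      atTop (𝓝 (φ (toAV m a)))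

/-- A quantum Markov state: a quantum Markov chain with `φ|_{Λ_n} ∘ E_{Λ_n} = φ|_{Λ_{n+1}}`. -/
structure IsQuantumMarkovState (φo : Alg d (ball k 0) →ₗ[ℂ] ℂ) (E : CPFamily k d)
    (h : ∀ n, Alg d (ball k n)) (φ : AV k d →ₗ[ℂ] ℂ) : Prop
    extends IsQuantumMarkovChain φo E h φ where
  markov : ∀ (n : ℕ) (a : Alg d (ball k (n + 1))), φ (toAV n (E n a)) = φ (toAV (n + 1) a)

/-- The transition expectations are localized: `E_{Λ_n} = id ⊗ ⨂_{x ∈ W_n} ℰ_x` with completely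
positive unital maps `ℰ_x : 𝒜_{{x} ∪ S(x)} → 𝒜_{x}`. (Both sides are linear, and the elementary
tensors span.) -/
def IsLocalized (E : CPFamily k d) : Prop :=
  ∃ F : ∀ x : Vertex k, Alg d (insert x (succs x)) →CP Alg d {x},
    (∀ x, F x 1 = 1) ∧
    ∀ (n : ℕ) (c : Alg d (below k n)) (a : ∀ x : Vertex k, Alg d (insert x (succs x))),
      E n (levelTensor n (below_mono (Nat.le_add_right n 2)) (fun _ hx => star_subset_ball hx) c a) =
        levelTensor n (below_mono (Nat.le_add_right n 1)) (fun _ hx => singleton_subset_ball hx) c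
          (fun x => F x (a x))

/-- `φ` is a quantum Markov state with localized transition expectations. -/
def IsLocalizedQMS (φ : AV k d →ₗ[ℂ] ℂ) : Prop :=
  ∃ (φo : Alg d (ball k 0) →ₗ[ℂ] ℂ) (E : CPFamily k d) (h : ∀ n, Alg d (ball k n)),
    IsQuantumMarkovState φo E h φ ∧ IsLocalized E

/-- `φ ∘ α_j = φ` for `j = 1, …, k`. -/
def IsTranslationInvariant (φ : AV k d →ₗ[ℂ] ℂ) : Prop :=
  ∀ (j : Fin k) (a : AV k d), φ (shift [j] a) = φ a

/-- A functional is faithful if it vanishes on no nonzero positive element. -/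
def IsFaithful (φ : AV k d →ₗ[ℂ] ℂ) : Prop :=
  ∀ a : AV k d, φ (star a * a) = 0 → a = 0

/-- `φ(a α_g(b)) → φ(a) φ(b)` as the level `|g|` tends to infinity. -/
def IsStronglyMixing (φ : AV k d →ₗ[ℂ] ℂ) : Prop :=
  ∀ a b : AV k d, Tendsto (fun g : Vertex k => φ (a * shift g b))
    (comap List.length atTop) (𝓝 (φ a * φ b))

end States

end
end TreeQMS

open TreeQMS

/-!
The state `φ` is invariant under the transition expectations, so a correlation `φ(a α_g(b))` can be
computed by conditioning `b` on lower and lower levels of the tree. The proof makes this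
conditioning a strict contraction for the norm `‖a‖² = φ(a* a)` of the GNS space, which is a genuine
norm because `φ` is faithful.

Reduction to one site. Elementary tensors span, and `E_{Λ_n}` maps an elementary tensor to an
elementary tensor, so `E_{Λ_n}` preserves the local algebras of the subtree at `g` as long as
`n ≥ |g|`. Hence `α_g(b)` may be replaced by an observable `β` at the site `g`, as far as correlations
with `𝒜_{Λ_{|g|-1}}` are concerned (`exists_site_of_shift`). The GNS norm does not increase, by the
Kadison–Schwarz inequality for the completely positive maps `E_{Λ_n}`.

One step down the tree. The maps `ℰ_x` themselves need not contract: for `ℰ_x(a ⊗ b) = ω(a) b` they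
transport the observables at a successor unchanged. They are therefore replaced by the orthogonal
projections `P_x` to their fixed points. A contraction `f` of a finite-dimensional inner product
space decomposes every vector as `q = P q + (r - f r)`, and the coboundary `r - f r` is invisible to
`φ(c ·)` for `c` in the levels below `x`. So an observable `q` at a successor of `x` may be replaced by
`t = P_x q`, an observable at `x` with `⟪t, q⟫ = ‖t‖²` (`exists_site_of_succ`).

Strict contraction. Observables at `x` and at a successor of `x` which agree as elements of `𝒜_V` are
scalar. So the finite-dimensional spaces of centred observables at the two sites meet trivially, and
the cosine of the angle between them is a number `C < 1` (`exists_correlation_le`). By translation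
invariance only the pairs (root, successor of the root) matter, and `C` can be taken uniform. Then
`‖t‖² = ⟪t, q⟫ ≤ C ‖t‖ ‖q‖`, that is `‖t‖ ≤ C ‖q‖` for centred `q`.

Iterating along the path from `g` to the level `m + 1` gives
`|φ(a α_g(b))| ≤ ‖a*‖ C ^ (|g| - m - 1) ‖b‖` for `a ∈ 𝒜_{Λ_m}` and a centred local observable `b`
(`norm_map_mul_shift_le`), and the general case follows by density, as states are contractive.
-/

namespace TreeQMS
/-! ### Inner product spaces -/

section InnerProductSpace

variable {H : Type*} [NormedAddCommGroup H] [InnerProductSpace ℂ H]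

/-- The cosine of the smallest principal angle of two finite-dimensional subspaces with trivial
intersection is less than `1`, because it is attained. -/
theorem exists_norm_inner_le_of_disjoint (K L : Submodule ℂ H) [FiniteDimensional ℂ K]
    [FiniteDimensional ℂ L] (h : Disjoint K L) :
    ∃ c : ℝ, 0 ≤ c ∧ c < 1 ∧ ∀ u ∈ K, ∀ v ∈ L, ‖⟪u, v⟫_ℂ‖ ≤ c * (‖u‖ * ‖v‖) := by
  set S : Set (K × L) := Metric.sphere 0 1 ×ˢ Metric.sphere 0 1
  have hS : IsCompact S := by
    have := FiniteDimensional.proper ℂ K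
    have := FiniteDimensional.proper ℂ L
    exact (isCompact_sphere _ _).prod (isCompact_sphere _ _)
  have hscale : ∀ c : ℝ, (∀ p ∈ S, ‖⟪(p.1 : H), (p.2 : H)⟫_ℂ‖ ≤ c) →
      ∀ u ∈ K, ∀ v ∈ L, ‖⟪u, v⟫_ℂ‖ ≤ c * (‖u‖ * ‖v‖) := by
    intro c hc u hu v hv
    rcases eq_or_ne u 0 with rfl | hu0
    · simp
    rcases eq_or_ne v 0 with rfl | hv0
    · simp
    have hu' : ‖u‖ ≠ 0 := norm_ne_zero_iff.2 hu0
    have hv' : ‖v‖ ≠ 0 := norm_ne_zero_iff.2 hv0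
    have := hc (((‖u‖⁻¹ : ℝ) : ℂ) • ⟨u, hu⟩, ((‖v‖⁻¹ : ℝ) : ℂ) • ⟨v, hv⟩) (by
      simp [S, norm_smul, hu', hv'])
    simp only [Submodule.coe_smul, inner_smul_left, inner_smul_right, norm_mul] at this
    simp only [Complex.conj_ofReal, Complex.norm_real, norm_inv, norm_norm] at this
    rw [← mul_assoc, ← mul_inv, inv_mul_le_iff₀ (by positivity)] at this
    linarith
  rcases S.eq_empty_or_nonempty with hE | hne
  · exact ⟨0, le_rfl, one_pos, hscale 0 (by simp [hE])⟩
  · obtain ⟨p, hp, hmax⟩ := hS.exists_isMaxOn hne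
      (f := fun p : K × L => ‖⟪(p.1 : H), (p.2 : H)⟫_ℂ‖) (by fun_prop)
    refine ⟨_, norm_nonneg _, ?_, hscale _ fun q hq => hmax hq⟩
    have h1 : ‖(p.1 : H)‖ = 1 := by simpa [S] using hp.1
    have h2 : ‖(p.2 : H)‖ = 1 := by simpa [S] using hp.2
    have hle := norm_inner_le_norm (𝕜 := ℂ) (p.1 : H) (p.2 : H)
    rw [h1, h2, one_mul] at hle
    refine lt_of_le_of_ne hle fun heq => ?_
    have hne1 : (p.1 : H) ≠ 0 := fun h0 => by simp [h0] at h1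
    have hne2 : (p.2 : H) ≠ 0 := fun h0 => by simp [h0] at h2
    obtain ⟨r, -, hr⟩ := (norm_inner_eq_norm_iff (𝕜 := ℂ) hne1 hne2).1 (by rw [heq, h1, h2, one_mul])
    exact hne2 (Submodule.disjoint_def.1 h _ (hr ▸ K.smul_mem r p.1.2) p.2.2)

/-- The fixed vectors of a contraction are orthogonal to its coboundaries `r - f r`. -/
theorem inner_sub_eq_zero_of_contraction {W : Type*} [AddCommGroup W] [Module ℂ W] (i : W →ₗ[ℂ] H)
    (f : W →ₗ[ℂ] W) (hf : ∀ w, ‖i (f w)‖ ≤ ‖i w‖) {p : W} (hp : f p = p) (r : W) :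
    ⟪i p, i (r - f r)⟫_ℂ = 0 := by
  -- Compare `‖t p + r‖` and `‖f (t p + r)‖` for the scalar `t = s z`, `s` real.
  set z := ⟪i p, i (r - f r)⟫_ℂ with hz
  have key : ∀ s : ℝ, ‖i r‖ ^ 2 - ‖i (f r)‖ ^ 2 + 2 * s * ‖z‖ ^ 2 ≥ 0 := by
    intro s
    set t : ℂ := s * z with ht
    have h := hf (t • p + r)
    have h2 := pow_le_pow_left₀ (norm_nonneg _) h 2
    rw [map_add, map_smul, hp, map_add, map_add, @norm_add_sq ℂ, @norm_add_sq ℂ] at h2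
    have h3 : ⟪i (t • p), i r⟫_ℂ - ⟪i (t • p), i (f r)⟫_ℂ = ((s * ‖z‖ ^ 2 : ℝ) : ℂ) := by
      rw [← inner_sub_right, ← map_sub, map_smul, inner_smul_left, ← hz, ht]
      rw [map_mul, Complex.conj_ofReal, mul_assoc, Complex.conj_mul']
      push_cast
      rfl
    have h4 := congrArg Complex.re h3
    rw [Complex.sub_re, Complex.ofReal_re] at h4
    simp only [RCLike.re_to_complex] at h2
    linarith
  by_contra hne
  have hpos : 0 < ‖z‖ ^ 2 := by have := norm_pos_iff.2 hne; positivity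
  have := key (-(‖i r‖ ^ 2 - ‖i (f r)‖ ^ 2 + 1) / (2 * ‖z‖ ^ 2))
  have e : 2 * (-(‖i r‖ ^ 2 - ‖i (f r)‖ ^ 2 + 1) / (2 * ‖z‖ ^ 2)) * ‖z‖ ^ 2 =
      -(‖i r‖ ^ 2 - ‖i (f r)‖ ^ 2 + 1) := by field_simp
  rw [e] at this
  linarith

/-- The finite-dimensional mean ergodic decomposition: every vector is the sum of its orthogonal
projection `p` to the fixed vectors of the contraction `f` and of a coboundary `r - f r`. -/
theorem exists_fixed_add_coboundary {W : Type*} [AddCommGroup W] [Module ℂ W]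
    [FiniteDimensional ℂ W] (i : W →ₗ[ℂ] H) (hi : Function.Injective i)
    (f : W →ₗ[ℂ] W) (hf : ∀ w, ‖i (f w)‖ ≤ ‖i w‖) (q : W) :
    ∃ p r : W, f p = p ∧ q = p + (r - f r) ∧ ⟪i p, i q⟫_ℂ = (‖i p‖ : ℂ) ^ 2 := by
  set g : W →ₗ[ℂ] W := LinearMap.id - f with hg
  have hgr : ∀ r, g r = r - f r := fun r => rfl
  have hker : ∀ p, p ∈ LinearMap.ker g ↔ f p = p := fun p => by
    rw [LinearMap.mem_ker, hgr, sub_eq_zero, eq_comm]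
  have hdisj : Disjoint (LinearMap.ker g) (LinearMap.range g) := by
    rw [Submodule.disjoint_def]
    rintro x hx ⟨r, rfl⟩
    have h0 := inner_sub_eq_zero_of_contraction i f hf ((hker _).1 hx) r
    rw [← hgr, inner_self_eq_zero] at h0
    exact hi (by rw [h0, map_zero])
  have htop : LinearMap.ker g ⊔ LinearMap.range g = ⊤ := by
    apply Submodule.eq_top_of_disjoint _ _ _ hdisj
    have := g.finrank_range_add_finrank_ker
    omega
  obtain ⟨p, hp, _, ⟨r, rfl⟩, hq⟩ := Submodule.mem_sup.1 (htop ▸ Submodule.mem_top : q ∈ _)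
  refine ⟨p, r, (hker p).1 hp, by rw [← hq, hgr], ?_⟩
  rw [← hq, hgr, map_add, inner_add_right,
    inner_sub_eq_zero_of_contraction i f hf ((hker p).1 hp) r, add_zero]
  exact inner_self_eq_norm_sq_to_K _

end InnerProductSpace

/-! ### The Kadison–Schwarz inequality -/

section KadisonSchwarz

variable {A B : Type*} [CStarAlgebra A] [PartialOrder A] [StarOrderedRing A]
  [CStarAlgebra B] [PartialOrder B] [StarOrderedRing B]

/-- A positive `2 × 2` matrix over a C⋆-algebra has a nonnegative value on the column `(1, -w)`. -/
theorem quadraticForm_nonneg_of_nonneg {N : CStarMatrix (Fin 2) (Fin 2) B} (hN : 0 ≤ N) (w : B) :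
    0 ≤ N 0 0 - N 0 1 * w - star w * N 1 0 + star w * N 1 1 * w := by
  rw [StarOrderedRing.nonneg_iff] at hN
  induction hN using AddSubmonoid.closure_induction with
  | mem N h =>
    obtain ⟨S, rfl⟩ := h
    have e : (star S * S) 0 0 - (star S * S) 0 1 * w - star w * (star S * S) 1 0 +
        star w * (star S * S) 1 1 * w =
        star (S 0 0 - S 0 1 * w) * (S 0 0 - S 0 1 * w) +
        star (S 1 0 - S 1 1 * w) * (S 1 0 - S 1 1 * w) := by
      simp only [CStarMatrix.mul_apply, Fin.sum_univ_two, CStarMatrix.star_apply, star_sub,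
        star_mul]
      noncomm_ring
    rw [e]
    exact add_nonneg (star_mul_self_nonneg _) (star_mul_self_nonneg _)
  | zero => simp
  | add M N _ _ hM hN =>
    have e := add_nonneg hM hN
    simp only [CStarMatrix.add_apply]
    convert e using 1
    noncomm_ring

/-- The Kadison–Schwarz inequality for a unital completely positive map, from the positivity of
the matrix `!![star y * y, star y; y, 1]`. -/
theorem star_mul_self_le_of_completelyPositive (E : A →CP B) (hE : E 1 = 1) (y : A) :
    star (E y) * E y ≤ E (star y * y) := by
  let R : CStarMatrix (Fin 2) (Fin 2) A := CStarMatrix.ofMatrix !![y, 1; 0, 0]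
  have hM : 0 ≤ (star R * R).map E := E.map_cstarMatrix_nonneg _ (star_mul_self_nonneg R)
  have hent : ∀ i j, (star R * R) i j = star (R 0 i) * R 0 j + star (R 1 i) * R 1 j := by
    intro i j
    simp [CStarMatrix.mul_apply, Fin.sum_univ_two, CStarMatrix.star_apply]
  have hstar : E (star y) = star (E y) := by
    have h := congrArg (fun M => M 0 1) (IsSelfAdjoint.of_nonneg hM).star_eq
    simp only [CStarMatrix.star_apply, CStarMatrix.map_apply, hent] at h
    simpa [R] using h.symm
  have h := quadraticForm_nonneg_of_nonneg hM (E y)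
  simp only [CStarMatrix.map_apply, hent] at h
  simpa [R, hE, hstar] using h

end KadisonSchwarz

/-! ### The GNS space -/

section GNS

universe u

/-- The GNS inner product space of a faithful state: the algebra itself with the inner product
`⟪a, b⟫ = φ (star a * b)`. It is not completed. -/
theorem IsState.exists_gns {A : Type u} [Ring A] [StarRing A] [Algebra ℂ A] [StarModule ℂ A]
    {φ : A →ₗ[ℂ] ℂ} (hφ : IsState φ) (hf : ∀ a, φ (star a * a) = 0 → a = 0) :
    ∃ (H : Type u) (_ : NormedAddCommGroup H) (_ : InnerProductSpace ℂ H) (Φ : A →ₗ[ℂ] H),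
      Function.Injective Φ ∧ ∀ a b, ⟪Φ a, Φ b⟫_ℂ = φ (star a * b) := by
  have hre : ∀ a, (φ (star a * a)).im = 0 := fun a => ((Complex.le_def.1 (hφ.nonneg a)).2).symm
  -- Polarization: positivity implies that the form is Hermitian.
  have hsymm : ∀ a b, (starRingEnd ℂ) (φ (star b * a)) = φ (star a * b) := by
    intro a b
    have h1 := hre (a + b)
    have h2 := hre (a + Complex.I • b)
    have ha := hre a
    have hb := hre b
    simp only [star_add, add_mul, mul_add, map_add, star_smul, smul_mul_assoc, mul_smul_comm,
      map_smul, smul_eq_mul, Complex.add_im, Complex.mul_im, Complex.I_re, Complex.I_im,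
      Complex.star_def, Complex.conj_I, Complex.neg_re, Complex.neg_im, Complex.mul_re, ha, hb]
      at h1 h2
    apply Complex.ext
    · rw [Complex.conj_re]; linarith
    · rw [Complex.conj_im]; linarith
  let core : InnerProductSpace.Core ℂ A :=
    { inner a b := φ (star a * b)
      conj_inner_symm a b := hsymm a b
      re_inner_nonneg a := (Complex.le_def.1 (hφ.nonneg a)).1
      add_left a b c := by simp [add_mul]
      smul_left a b r := by simp
      definite := hf }
  let _ : NormedAddCommGroup A := core.toNormedAddCommGroup
  let _ : InnerProductSpace ℂ A := InnerProductSpace.ofCore core.toCore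
  exact ⟨A, ‹_›, ‹_›, LinearMap.id, Function.injective_id, fun a b => rfl⟩

end GNS

/-! ### Local algebras of arbitrary finite regions -/

section Regions

variable {k d : ℕ}

theorem subset_ball_sup_length (Λ : Finset (Vertex k)) : Λ ⊆ ball k (Λ.sup List.length) :=
  fun _ hx => mem_below.2 (Nat.lt_succ_of_le (Finset.le_sup (f := List.length) hx))

/-- The embedding of `𝒜_Λ` into `𝒜_V`, for an arbitrary finite region `Λ`. -/
noncomputable def locAV (Λ : Finset (Vertex k)) : Alg d Λ →⋆ₐ[ℂ] AV k d :=
  (locRep Λ).codRestrict (quasiLocal k d) fun a => by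
    rw [← locRep_incl (subset_ball_sup_length Λ)]
    exact locRep_mem _ _

theorem toAV_eq_locAV (n : ℕ) : toAV (d := d) n = locAV (ball k n) := rfl

theorem locAV_incl {Λ Λ' : Finset (Vertex k)} (h : Λ ⊆ Λ') (a : Alg d Λ) :
    locAV Λ' (incl h a) = locAV Λ a :=
  Subtype.ext (locRep_incl h a)

theorem locAV_injective (hd : 1 ≤ d) (Λ : Finset (Vertex k)) :
    Function.Injective (locAV (d := d) Λ) := by
  refine (injective_iff_map_eq_zero _).2 fun a ha => ?_
  have ha' : locRep Λ a = 0 := congrArg Subtype.val ha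
  let o : Fin d := ⟨0, hd⟩
  let ext : (Λ → Fin d) → (Vertex k → Fin d) := fun η =>
    Function.extend (Function.Embedding.subtype (· ∈ Λ)) η fun _ => o
  have hext : ∀ η (x : Λ), ext η x = η x := fun η x =>
    Subtype.val_injective.extend_apply η _ x
  have hee : ∀ σ η, Function.extend (Function.Embedding.subtype (· ∈ Λ)) η (ext σ) = ext η := by
    intro σ η
    funext v
    by_cases hv : ∃ u, Function.Embedding.subtype (· ∈ Λ) u = v
    · obtain ⟨u, rfl⟩ := hv
      rw [(Function.Embedding.injective _).extend_apply]
      exact (hext η u).symm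
    · simp only [ext]
      rw [Function.extend_apply' _ _ _ hv, Function.extend_apply' _ _ _ hv,
        Function.extend_apply' _ _ _ hv]
  classical
  ext σ τ
  -- The matrix entry is read off from the action on a basis vector.
  have h := locRep_apply Λ a (lp.single 2 (ext τ) (1 : ℂ)) (ext σ)
  rw [ha'] at h
  rw [Finset.sum_eq_single τ] at h
  · rw [hee, lp.single_apply_self, mul_one] at h
    simpa [hext] using h.symm
  · intro η _ hη
    rw [hee, lp.single_apply_ne, mul_zero]
    intro he
    exact hη (funext fun x => by rw [← hext η x, ← hext τ x, he])
  · simp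

theorem shift_locAV (g : Vertex k) {Λ Λ' : Finset (Vertex k)} (e : Λ ≃ Λ')
    (he : ∀ x : Λ, (e x : Vertex k) = g ++ x) (a : Alg d Λ) :
    shift g (locAV Λ a) =
      locAV Λ' (CStarMatrix.ofMatrix fun σ τ => a (σ ∘ e) (τ ∘ e)) := by
  refine Subtype.ext ?_
  change ampHom (vertexShift g) (Fin d) (locRep Λ a) = locRep Λ' _
  ext ψ σ
  rw [ampHom_apply, locRep_apply, locRep_apply]
  refine Fintype.sum_equiv (e.arrowCongr (Equiv.refl (Fin d))) _ _ fun η => ?_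
  have h1 : (fun x : Λ' => σ x) ∘ e = fun x : Λ => (σ ∘ vertexShift g) x :=
    funext fun x => congrArg σ (he x)
  have h2 : (e.arrowCongr (Equiv.refl (Fin d)) η) ∘ e = η := by
    funext x; simp [Equiv.arrowCongr]
  change _ = a ((fun x : Λ' => σ x) ∘ e) (e.arrowCongr (Equiv.refl (Fin d)) η ∘ e) * _
  rw [h1, h2, slice_apply]
  congr 2
  rw [← Function.Injective.extend_comp (Function.Embedding.injective _)
    (vertexShift g).injective η σ]
  have h3 : (vertexShift g) ∘ (Function.Embedding.subtype (· ∈ Λ)) =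
      (Function.Embedding.subtype (· ∈ Λ')) ∘ e := funext fun x => (he x).symm
  rw [h3]
  refine congrArg ψ (funext fun v => ?_)
  by_cases hv : v ∈ Λ'
  · have hi : Function.Injective ((Function.Embedding.subtype (· ∈ Λ')) ∘ e) :=
      (Function.Embedding.injective _).comp e.injective
    have hv' : ((Function.Embedding.subtype (· ∈ Λ')) ∘ e) (e.symm ⟨v, hv⟩) = v := by simp
    have hv'' : Function.Embedding.subtype (· ∈ Λ') ⟨v, hv⟩ = v := rfl
    conv_lhs => rw [← hv']
    conv_rhs => rw [← hv'']
    rw [hi.extend_apply, (Function.Embedding.injective _).extend_apply]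
    rfl
  · rw [Function.extend_apply', Function.extend_apply']
    · rintro ⟨x, rfl⟩
      exact hv x.2
    · rintro ⟨x, rfl⟩
      exact hv (e x).2

/-- The embedding of `M_d` into `𝒜_V` at the site `x`. -/
noncomputable def site (x : Vertex k) : Matrix (Fin d) (Fin d) ℂ →ₗ[ℂ] AV k d where
  toFun b := locAV {x} (CStarMatrix.ofMatrix fun σ τ =>
    b (σ ⟨x, Finset.mem_singleton_self x⟩) (τ ⟨x, Finset.mem_singleton_self x⟩))
  map_add' b c := by rw [← map_add]; rfl
  map_smul' t b := by rw [← map_smul]; rfl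

/-- An element of `𝒜_{x}` as an element of `M_d`. -/
def siteMatrix (x : Vertex k) (a : Alg d {x}) : Matrix (Fin d) (Fin d) ℂ :=
  Matrix.of fun i j => a (fun _ => i) (fun _ => j)

theorem siteMatrix_apply (x : Vertex k) (a : Alg d {x}) (σ τ : ({x} : Finset (Vertex k)) → Fin d)
    (y : ({x} : Finset (Vertex k))) : siteMatrix x a (σ y) (τ y) = a σ τ := by
  change a (fun _ => _) (fun _ => _) = a σ τ
  congr 1 <;>
  · funext z
    congr 1
    exact Subsingleton.elim _ _

theorem siteMatrix_one (x : Vertex k) : siteMatrix (d := d) x 1 = 1 := by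
  ext i j
  change (1 : Alg d {x}) (fun _ => i) (fun _ => j) = _
  rw [CStarMatrix.one_apply, Matrix.one_apply]
  exact if_congr ⟨fun h => congrFun h ⟨x, Finset.mem_singleton_self x⟩, fun h => by rw [h]⟩ rfl rfl

theorem locAV_singleton (x : Vertex k) (a : Alg d {x}) :
    locAV {x} a = site x (siteMatrix x a) := by
  refine congrArg (locAV {x}) ?_
  ext σ τ
  exact (siteMatrix_apply x a σ τ _).symm

theorem shift_site (g x : Vertex k) (b : Matrix (Fin d) (Fin d) ℂ) :
    shift g (site x b) = site (g ++ x) b := by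
  let e : ({x} : Finset (Vertex k)) ≃ ({g ++ x} : Finset (Vertex k)) := Equiv.ofUnique _ _
  exact shift_locAV g e (fun y => by
    rw [Finset.mem_singleton.1 (e y).2, Finset.mem_singleton.1 y.2]) _

theorem site_one (x : Vertex k) : site (d := d) x 1 = 1 := by
  refine Eq.trans (congrArg (locAV {x}) ?_) (map_one (locAV {x}))
  ext σ τ
  change (1 : Matrix (Fin d) (Fin d) ℂ) _ _ = (1 : Alg d {x}) σ τ
  rw [Matrix.one_apply, CStarMatrix.one_apply]
  refine if_congr ⟨fun h => funext fun y => ?_, fun h => by rw [h]⟩ rfl rfl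
  obtain ⟨y, hy⟩ := y
  obtain rfl := Finset.mem_singleton.1 hy
  exact h

theorem shift_append (g h : Vertex k) (a : AV k d) : shift (g ++ h) a = shift g (shift h a) := by
  refine Subtype.ext ?_
  change ampHom (vertexShift (g ++ h)) (Fin d) (AV.toOp a) =
    ampHom (vertexShift g) (Fin d) (ampHom (vertexShift h) (Fin d) (AV.toOp a))
  rw [← ampHom_trans]
  congr 2
  ext x : 1
  exact List.append_assoc g h x

theorem shift_nil (a : AV k d) : shift [] a = a := by
  refine Subtype.ext ?_
  change ampHom (vertexShift []) (Fin d) (AV.toOp a) = AV.toOp a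
  ext ψ σ
  have hs : slice (vertexShift []) σ ψ = ψ := by
    ext η
    exact congrArg ψ (funext fun v => (vertexShift (k := k) []).injective.extend_apply η σ v)
  rw [ampHom_apply, hs]
  rfl

theorem IsTranslationInvariant.map_shift {φ : AV k d →ₗ[ℂ] ℂ} (h : IsTranslationInvariant φ)
    (g : Vertex k) (a : AV k d) : φ (shift g a) = φ a := by
  induction g with
  | nil => rw [shift_nil]
  | cons j g ih => rw [← List.singleton_append, shift_append, h, ih]

end Regions

/-! ### Elementary tensors -/

section ElementaryTensors

variable {k d : ℕ}

/-- The elementary tensor `⨂_{x ∈ Λ} a_x`. -/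
noncomputable def ten (Λ : Finset (Vertex k)) (a : Vertex k → Matrix (Fin d) (Fin d) ℂ) : Alg d Λ :=
  CStarMatrix.ofMatrix fun σ τ => ∏ x : Λ, a x (σ x) (τ x)

theorem ten_apply (Λ : Finset (Vertex k)) (a : Vertex k → Matrix (Fin d) (Fin d) ℂ)
    (σ τ : Λ → Fin d) : ten Λ a σ τ = ∏ x : Λ, a x (σ x) (τ x) := rfl

theorem ten_congr {Λ : Finset (Vertex k)} {a b : Vertex k → Matrix (Fin d) (Fin d) ℂ}
    (h : ∀ x ∈ Λ, a x = b x) : ten Λ a = ten Λ b := by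
  ext σ τ
  exact Finset.prod_congr rfl fun x _ => by rw [h x x.2]

theorem ten_one (Λ : Finset (Vertex k)) : ten (d := d) Λ (fun _ => 1) = 1 := by
  ext σ τ
  rw [ten_apply, CStarMatrix.one_apply]
  simp only [Matrix.one_apply, Finset.prod_ite_zero, Finset.prod_const_one]
  exact if_congr (by simp [funext_iff]) rfl rfl

open Classical in
/-- The factor of the site `v` in the entry `(σ, τ)` of an elementary tensor, and `1` off `Λ`. -/
noncomputable def tenFactor {Λ : Finset (Vertex k)} (a : Vertex k → Matrix (Fin d) (Fin d) ℂ)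
    (σ τ : Λ → Fin d) (v : Vertex k) : ℂ :=
  if h : v ∈ Λ then a v (σ ⟨v, h⟩) (τ ⟨v, h⟩) else 1

theorem ten_restrict {Λ Λ' : Finset (Vertex k)} (h : Λ ⊆ Λ')
    (a : Vertex k → Matrix (Fin d) (Fin d) ℂ) (σ τ : Λ' → Fin d) :
    ten Λ a (Finset.restrict₂ (π := fun _ => Fin d) h σ)
      (Finset.restrict₂ (π := fun _ => Fin d) h τ) = ∏ v ∈ Λ, tenFactor a σ τ v := by
  rw [ten_apply, ← Finset.prod_coe_sort Λ]
  refine Finset.prod_congr rfl fun x _ => ?_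
  rw [tenFactor, dif_pos (h x.2)]
  rfl

theorem ten_apply_eq_prod {Λ : Finset (Vertex k)}
    (a : Vertex k → Matrix (Fin d) (Fin d) ℂ) (σ τ : Λ → Fin d) :
    ten Λ a σ τ = ∏ v ∈ Λ, tenFactor a σ τ v :=
  ten_restrict subset_rfl a σ τ

theorem incl_ten {Λ Λ' : Finset (Vertex k)} (h : Λ ⊆ Λ')
    {a : Vertex k → Matrix (Fin d) (Fin d) ℂ} (ha : ∀ x ∉ Λ, a x = 1) :
    incl h (ten Λ a) = ten Λ' a := by
  ext σ τ
  rw [ten_apply_eq_prod]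
  by_cases hστ : ∀ x : Λ', x.1 ∉ Λ → σ x = τ x
  · refine (if_pos hστ).trans ?_
    rw [ten_restrict]
    refine Finset.prod_subset h fun v hv hv' => ?_
    rw [tenFactor, dif_pos hv, ha v hv', Matrix.one_apply, if_pos (hστ ⟨v, hv⟩ hv')]
  · refine (if_neg hστ).trans ?_
    push Not at hστ
    obtain ⟨x, hx, hne⟩ := hστ
    refine (Finset.prod_eq_zero x.2 ?_).symm
    rw [tenFactor, dif_pos x.2, ha x hx, Matrix.one_apply, if_neg hne]

theorem ten_singleton {x : Vertex k} {a : Vertex k → Matrix (Fin d) (Fin d) ℂ} {b : Alg d {x}}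
    (h : a x = siteMatrix x b) : ten {x} a = b := by
  ext σ τ
  rw [ten_apply, Fintype.prod_subsingleton _ ⟨x, Finset.mem_singleton_self x⟩, h, siteMatrix_apply]

theorem incl_apply {Λ Λ' : Finset (Vertex k)} (h : Λ ⊆ Λ') (a : Alg d Λ) (σ τ : Λ' → Fin d) :
    incl h a σ τ = if ∀ x : Λ', x.1 ∉ Λ → σ x = τ x then
      a (Finset.restrict₂ (π := fun _ => Fin d) h σ) (Finset.restrict₂ (π := fun _ => Fin d) h τ)
    else 0 := rfl

/-- The inclusion `a ↦ a ⊗ 1` as a linear map. -/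
def inclₗ {Λ Λ' : Finset (Vertex k)} (h : Λ ⊆ Λ') : Alg d Λ →ₗ[ℂ] Alg d Λ' where
  toFun := incl h
  map_add' a b := by
    ext σ τ
    rw [CStarMatrix.add_apply, incl_apply, incl_apply, incl_apply]
    split_ifs
    · rfl
    · simp
  map_smul' c a := by
    ext σ τ
    rw [CStarMatrix.smul_apply, incl_apply, incl_apply]
    split_ifs
    · rfl
    · simp

/-- The elementary tensors span the local algebra. -/
theorem span_range_ten (Λ : Finset (Vertex k)) :
    Submodule.span ℂ (ten (d := d) Λ '' {a | ∀ x ∉ Λ, a x = 1}) = ⊤ := by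
  classical
  rw [Submodule.eq_top_iff']
  intro b
  let u : (Λ → Fin d) → (Λ → Fin d) → Vertex k → Matrix (Fin d) (Fin d) ℂ := fun σ τ x =>
    if h : x ∈ Λ then Matrix.single (σ ⟨x, h⟩) (τ ⟨x, h⟩) 1 else 1
  have hb : b = ∑ σ, ∑ τ, b σ τ • ten Λ (u σ τ) := by
    have hu : ∀ σ τ σ' τ', ten Λ (u σ τ) σ' τ' = if σ = σ' ∧ τ = τ' then 1 else 0 := by
      intro σ τ σ' τ'
      rw [ten_apply]
      have : ∀ x : Λ, u σ τ x (σ' x) (τ' x) = if σ x = σ' x ∧ τ x = τ' x then 1 else 0 := by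
        intro x
        simp only [u, dif_pos x.2, Matrix.single_apply]
      simp only [this, Finset.prod_ite_zero, Finset.prod_const_one]
      exact if_congr (by simp [funext_iff, forall_and]) rfl rfl
    have hsum : ∀ (S : Finset (Λ → Fin d)) (F : (Λ → Fin d) → Alg d Λ) (σ' τ' : Λ → Fin d),
        (∑ σ ∈ S, F σ) σ' τ' = ∑ σ ∈ S, F σ σ' τ' := fun S F σ' τ' => by
      induction S using Finset.induction_on with
      | empty => simp
      | insert x S hx ih => rw [Finset.sum_insert hx, Finset.sum_insert hx, CStarMatrix.add_apply, ih]
    ext σ' τ'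
    simp only [hsum, CStarMatrix.smul_apply, hu, smul_eq_mul, mul_ite, mul_one, mul_zero, ite_and]
    simp
  rw [hb]
  refine Submodule.sum_mem _ fun σ _ => Submodule.sum_mem _ fun τ _ => Submodule.smul_mem _ _
    (Submodule.subset_span ⟨u σ τ, fun x hx => dif_neg hx, rfl⟩)

theorem levelTensor_ten (n : ℕ) {Λ : Finset (Vertex k)} {R : Vertex k → Finset (Vertex k)}
    (hc : below k n ⊆ Λ) (hR : ∀ x ∈ level k n, R x ⊆ Λ)
    (hdisj : Set.PairwiseDisjoint (level k n : Set (Vertex k)) R)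
    (hdisj' : ∀ x ∈ level k n, Disjoint (below k n) (R x))
    (hΛ : Λ ⊆ below k n ∪ (level k n).biUnion R)
    (a : Vertex k → Matrix (Fin d) (Fin d) ℂ) :
    levelTensor n hc hR (ten (below k n) a) (fun x => ten (R x) a) = ten Λ a := by
  have hΛ' : Λ = below k n ∪ (level k n).biUnion R :=
    hΛ.antisymm (Finset.union_subset hc (Finset.biUnion_subset.2 hR))
  ext σ τ
  rw [ten_apply_eq_prod]
  have hp : ∏ v ∈ Λ, tenFactor a σ τ v =
      (∏ v ∈ below k n, tenFactor a σ τ v) *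
        ∏ x ∈ level k n, ∏ v ∈ R x, tenFactor a σ τ v := by
    rw [← Finset.prod_biUnion hdisj, ← Finset.prod_union
      ((Finset.disjoint_biUnion_right _ _ _).2 hdisj'), ← hΛ']
  rw [hp, ← ten_restrict hc, ← Finset.prod_coe_sort (level k n)]
  exact congrArg₂ (· * ·) rfl
    (Finset.prod_congr rfl fun (x : level k n) _ => ten_restrict (hR x x.2) a σ τ)

end ElementaryTensors

/-! ### Localized transition expectations -/

section Localized

variable {k d : ℕ}

theorem mem_succs {x y : Vertex k} : y ∈ succs x ↔ ∃ i, x ++ [i] = y := by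
  simp [succs]

theorem mem_star {x y : Vertex k} : y ∈ insert x (succs x) ↔ y = x ∨ ∃ i, x ++ [i] = y := by
  rw [Finset.mem_insert, mem_succs]

theorem pairwiseDisjoint_star (n : ℕ) : Set.PairwiseDisjoint (level k n : Set (Vertex k))
    fun x => insert x (succs x) := by
  intro x hx y hy hxy
  rw [Finset.mem_coe, mem_level] at hx hy
  rw [Function.onFun, Finset.disjoint_left]
  intro z hzx hzy
  rcases mem_star.1 hzx with rfl | ⟨i, rfl⟩ <;> rcases mem_star.1 hzy with h | ⟨j, h⟩
  · exact hxy h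
  · have := congrArg List.length h; simp at this; omega
  · have := congrArg List.length h; simp at this; omega
  · exact hxy (List.append_inj' h rfl).1.symm

theorem disjoint_below_star {n : ℕ} {x : Vertex k} (hx : x ∈ level k n) :
    Disjoint (below k n) (insert x (succs x)) := by
  rw [mem_level] at hx
  rw [Finset.disjoint_left]
  intro z hz hzx
  rw [mem_below] at hz
  rcases mem_star.1 hzx with rfl | ⟨i, rfl⟩
  · omega
  · simp at hz; omega

theorem ball_succ_subset_stars (n : ℕ) : ball k (n + 1) ⊆
    below k n ∪ (level k n).biUnion fun x => insert x (succs x) := by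
  intro z hz
  rw [mem_below] at hz
  rw [Finset.mem_union, mem_below, Finset.mem_biUnion]
  rcases lt_trichotomy z.length n with h | h | h
  · exact Or.inl h
  · exact Or.inr ⟨z, mem_level.2 h, Finset.mem_insert_self _ _⟩
  · have hz0 : z ≠ [] := by rintro rfl; simp at h
    refine Or.inr ⟨z.dropLast, mem_level.2 (by rw [List.length_dropLast]; omega), mem_star.2
      (Or.inr ⟨z.getLast hz0, List.dropLast_append_getLast hz0⟩)⟩

theorem ball_subset_singletons (n : ℕ) : ball k n ⊆ below k n ∪ (level k n).biUnion
    fun x => {x} := by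
  intro z hz
  rw [mem_below] at hz
  rw [Finset.mem_union, mem_below, Finset.mem_biUnion]
  rcases lt_or_eq_of_le (Nat.le_of_lt_succ hz) with h | h
  · exact Or.inl h
  · exact Or.inr ⟨z, mem_level.2 h, Finset.mem_singleton_self _⟩

theorem levelTensor_congr {n : ℕ} {Λ : Finset (Vertex k)} {R : Vertex k → Finset (Vertex k)}
    (hc : below k n ⊆ Λ) (hR : ∀ x ∈ level k n, R x ⊆ Λ)
    {c c' : Alg d (below k n)} {a a' : ∀ x, Alg d (R x)} (h : c = c')
    (h' : ∀ x ∈ level k n, a x = a' x) : levelTensor n hc hR c a = levelTensor n hc hR c' a' := by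
  subst h
  have h'' : ∀ x : level k n, a x = a' x := fun x => h' x x.2
  simp only [levelTensor, h'']

/-- The transition expectations `ℰ_x` localize `E`. This is the content of `IsLocalized E` for a
given family `F`. -/
structure LocalizedBy (E : CPFamily k d)
    (F : ∀ x : Vertex k, Alg d (insert x (succs x)) →CP Alg d {x}) : Prop where
  map_one : ∀ x, F x 1 = 1
  map_levelTensor : ∀ (n : ℕ) (c : Alg d (below k n))
    (a : ∀ x : Vertex k, Alg d (insert x (succs x))),
      E n (levelTensor n (below_mono (Nat.le_add_right n 2))
          (fun _ hx => star_subset_ball hx) c a) =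
        levelTensor n (below_mono (Nat.le_add_right n 1))
          (fun _ hx => singleton_subset_ball hx) c (fun x => F x (a x))

/-- The effect of `E_{Λ_n}` on the factors of an elementary tensor: the factors at level `n + 1` are
absorbed into those at level `n`. All factors above level `n` are set to `1`. -/
noncomputable def tenStep (F : ∀ x : Vertex k, Alg d (insert x (succs x)) →CP Alg d {x}) (n : ℕ)
    (a : Vertex k → Matrix (Fin d) (Fin d) ℂ) (x : Vertex k) : Matrix (Fin d) (Fin d) ℂ :=
  if x.length < n then a x
  else if x.length = n then siteMatrix x (F x (ten (insert x (succs x)) a)) else 1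

variable {E : CPFamily k d} {F : ∀ x : Vertex k, Alg d (insert x (succs x)) →CP Alg d {x}}

theorem LocalizedBy.map_ten (h : LocalizedBy E F) (n : ℕ)
    (a : Vertex k → Matrix (Fin d) (Fin d) ℂ) :
    E n (ten (ball k (n + 1)) a) = ten (ball k n) (tenStep F n a) := by
  rw [← levelTensor_ten n (below_mono (Nat.le_add_right n 2)) (fun _ hx => star_subset_ball hx)
    (pairwiseDisjoint_star n) (fun _ hx => disjoint_below_star hx) (ball_succ_subset_stars n) a,
    h.map_levelTensor]
  rw [← levelTensor_ten n (below_mono (Nat.le_add_right n 1))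
    (fun _ hx => singleton_subset_ball hx) (fun x _ y _ hxy => Finset.disjoint_singleton.2 hxy)
    (fun x hx => Finset.disjoint_singleton_right.2 fun hx' => by
      rw [mem_level] at hx; rw [mem_below] at hx'; omega) (ball_subset_singletons n)]
  refine levelTensor_congr _ _ (ten_congr fun x hx => ?_) fun x hx => (ten_singleton ?_).symm
  · rw [tenStep, if_pos (mem_below.1 hx)]
  · rw [mem_level] at hx
    rw [tenStep, if_neg (by omega), if_pos hx]

/-- A factor of `tenStep F n a` is trivial if all factors of `a` that it depends on are. -/
theorem LocalizedBy.tenStep_eq_one (h : LocalizedBy E F) {n : ℕ}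
    {a : Vertex k → Matrix (Fin d) (Fin d) ℂ} {x : Vertex k} (hx : x.length < n → a x = 1)
    (hx' : x.length = n → ∀ y ∈ insert x (succs x), a y = 1) : tenStep F n a x = 1 := by
  rw [tenStep]
  split_ifs with h1 h2
  · exact hx h1
  · rw [ten_congr (hx' h2), ten_one, h.map_one, siteMatrix_one]
  · rfl

/-- `E_{Λ_n}` acts on the star of a vertex of level `n` as the transition expectation. -/
theorem LocalizedBy.map_incl_star (h : LocalizedBy E F) {n : ℕ} {x : Vertex k}
    (hx : x ∈ level k n) (w : Alg d (insert x (succs x))) :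
    E n (incl (star_subset_ball hx) w) = incl (singleton_subset_ball hx) (F x w) := by
  have hle : (⊤ : Submodule ℂ (Alg d (insert x (succs x)))) ≤ LinearMap.eqLocus
      ((E n).toLinearMap ∘ₗ inclₗ (star_subset_ball hx))
      (inclₗ (singleton_subset_ball hx) ∘ₗ (F x).toLinearMap) := by
    rw [← span_range_ten, Submodule.span_le]
    rintro _ ⟨a, ha, rfl⟩
    change E n (incl _ (ten _ a)) = incl _ (F x (ten _ a))
    have hxn := mem_level.1 hx
    rw [incl_ten _ ha, h.map_ten, ← incl_ten (singleton_subset_ball hx) fun y hy => ?_]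
    · rw [ten_singleton]
      rw [tenStep, if_neg (by omega), if_pos hxn]
    · rw [Finset.mem_singleton] at hy
      refine h.tenStep_eq_one (fun hyn => ha y fun hyx => ?_) fun hyn z hz => ha z fun hzx => ?_
      · exact Finset.disjoint_left.1 (disjoint_below_star hx) (mem_below.2 hyn) hyx
      · exact Finset.disjoint_left.1 (pairwiseDisjoint_star n (Finset.mem_coe.2 (mem_level.2 hyn))
          (Finset.mem_coe.2 hx) hy) hz hzx
  exact hle (Submodule.mem_top : w ∈ ⊤)

/-- The vertices of the subtree at `g` of level `≤ n`. -/
def subtree (g : Vertex k) (n : ℕ) : Finset (Vertex k) := (ball k n).filter (g <+: ·)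

theorem mem_subtree {g x : Vertex k} {n : ℕ} : x ∈ subtree g n ↔ x.length ≤ n ∧ g <+: x := by
  rw [subtree, Finset.mem_filter, mem_below, Nat.lt_succ_iff]

theorem subtree_subset_ball (g : Vertex k) (n : ℕ) : subtree g n ⊆ ball k n :=
  Finset.filter_subset _ _

/-- The transition expectations preserve the local algebras of a subtree. -/
theorem LocalizedBy.exists_map_incl_subtree (h : LocalizedBy E F) {g : Vertex k} {n : ℕ}
    (hn : g.length ≤ n) (w : Alg d (subtree g (n + 1))) :
    ∃ w' : Alg d (subtree g n), E n (incl (subtree_subset_ball g (n + 1)) w) =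
      incl (subtree_subset_ball g n) w' := by
  have hle : (⊤ : Submodule ℂ (Alg d (subtree g (n + 1)))) ≤ Submodule.comap
      ((E n).toLinearMap ∘ₗ inclₗ (subtree_subset_ball g (n + 1)))
      (LinearMap.range (inclₗ (subtree_subset_ball g n))) := by
    rw [← span_range_ten, Submodule.span_le]
    rintro _ ⟨a, ha, rfl⟩
    refine ⟨ten _ (tenStep F n a), ?_⟩
    change incl _ (ten _ _) = E n (incl _ (ten _ a))
    rw [incl_ten _ ha, h.map_ten, incl_ten]
    intro y hy
    rw [mem_subtree, not_and] at hy
    refine h.tenStep_eq_one (fun hyn => ha y fun hy' => hy hyn.le (mem_subtree.1 hy').2)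
      fun hyn z hz => ha z fun hz' => hy hyn.le ?_
    rw [mem_subtree] at hz'
    rcases mem_star.1 hz with rfl | ⟨i, rfl⟩
    · exact hz'.2
    -- A prefix of `y ++ [i]` of length at most that of `y` is a prefix of `y`.
    · exact List.prefix_of_prefix_length_le hz'.2 (List.prefix_append y [i]) (by omega)
  obtain ⟨w', hw'⟩ := hle (Submodule.mem_top : w ∈ ⊤)
  exact ⟨w', hw'.symm⟩

end Localized

/-! ### Correlations in a Markov state -/

theorem norm_sq_gns {A : Type*} [Ring A] [StarRing A] [Algebra ℂ A] {φ : A →ₗ[ℂ] ℂ} {H : Type*}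
    [NormedAddCommGroup H] [InnerProductSpace ℂ H] {Φ : A →ₗ[ℂ] H}
    (hΦ : ∀ a b, ⟪Φ a, Φ b⟫_ℂ = φ (star a * b)) (a : A) : ‖Φ a‖ ^ 2 = (φ (star a * a)).re := by
  rw [← hΦ, inner_self_eq_norm_sq_to_K]
  norm_cast

section Correlations

open Filter Topology

variable {k d : ℕ} {φ : AV k d →ₗ[ℂ] ℂ} {φo : Alg d (ball k 0) →ₗ[ℂ] ℂ} {E : CPFamily k d}
  {h : ∀ n, Alg d (ball k n)} {F : ∀ x : Vertex k, Alg d (insert x (succs x)) →CP Alg d {x}}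
  {H : Type*} [NormedAddCommGroup H] [InnerProductSpace ℂ H] {Φ : AV k d →ₗ[ℂ] H}

/-- The Markov property, with an observable `c` of the levels below `n` as a spectator. -/
theorem map_mul_locAV_map (hφ : IsQuantumMarkovState φo E h φ) {n : ℕ} (c : Alg d (below k n))
    (y : Alg d (ball k (n + 1))) :
    φ (locAV _ c * locAV _ y) = φ (locAV _ c * locAV _ (E n y)) := by
  rw [← locAV_incl (below_mono (Nat.le_add_right n 2)) c, ← map_mul, ← toAV_eq_locAV,
    ← hφ.markov, (hφ.quasi n).map_incl_mul, map_mul, toAV_eq_locAV, toAV_eq_locAV, locAV_incl,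
    locAV_incl]

/-- The transition expectations contract the GNS norm, by the Kadison–Schwarz inequality. -/
theorem norm_gns_map_le (hφ : IsQuantumMarkovState φo E h φ)
    (hΦ : ∀ a b, ⟪Φ a, Φ b⟫_ℂ = φ (star a * b)) (n : ℕ) (y : Alg d (ball k (n + 1))) :
    ‖Φ (locAV _ (E n y))‖ ≤ ‖Φ (locAV _ y)‖ := by
  have hpos : ∀ D : Alg d (ball k n), 0 ≤ D → 0 ≤ φ (locAV _ D) := by
    intro D hD
    rw [StarOrderedRing.nonneg_iff] at hD
    induction hD using AddSubmonoid.closure_induction with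
    | mem D hD =>
      obtain ⟨z, rfl⟩ := hD
      rw [map_mul, map_star]
      exact hφ.state.nonneg _
    | zero => simp
    | add D D' _ _ h1 h2 => rw [map_add, map_add]; exact add_nonneg h1 h2
  have hKS := hpos _ (sub_nonneg.2
    (star_mul_self_le_of_completelyPositive (E n) (hφ.quasi n).map_one y))
  rw [map_sub, map_sub, ← toAV_eq_locAV, hφ.markov, sub_nonneg, toAV_eq_locAV, toAV_eq_locAV,
    map_mul (locAV _), map_mul (locAV _), map_star (locAV _), map_star (locAV _)] at hKS
  rw [← sq_le_sq₀ (norm_nonneg _) (norm_nonneg _), norm_sq_gns hΦ, norm_sq_gns hΦ]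
  exact (Complex.le_def.1 hKS).1

/-- An observable in the subtree at `g` can be replaced by an observable at the site `g`, as far as
correlations with the levels below that of `g` are concerned. -/
theorem exists_site_of_subtree (hφ : IsQuantumMarkovState φo E h φ) (hF : LocalizedBy E F)
    (hΦ : ∀ a b, ⟪Φ a, Φ b⟫_ℂ = φ (star a * b)) (g : Vertex k) (M : ℕ)
    (w : Alg d (subtree g (g.length + M))) :
    ∃ β, (∀ c : Alg d (below k g.length),
      φ (locAV _ c * locAV _ w) = φ (locAV _ c * site g β)) ∧
      ‖Φ (site g β)‖ ≤ ‖Φ (locAV _ w)‖ := by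
  induction M with
  | zero =>
    have hg : subtree g (g.length + 0) = {g} := by
      ext x
      rw [mem_subtree, Finset.mem_singleton]
      refine ⟨fun hx => (hx.2.eq_of_length_le hx.1).symm, ?_⟩
      rintro rfl
      exact ⟨le_rfl, List.prefix_rfl⟩
    revert w
    rw [hg]
    intro w
    exact ⟨siteMatrix g w, fun c => by rw [locAV_singleton], by rw [locAV_singleton]⟩
  | succ M ih =>
    obtain ⟨w', hw'⟩ := hF.exists_map_incl_subtree (g := g) (n := g.length + M) (by omega) w
    obtain ⟨β, h1, h2⟩ := ih w'
    have e1 : locAV _ w = locAV _ (incl (subtree_subset_ball g (g.length + M + 1)) w) :=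
      (locAV_incl _ w).symm
    have e2 := locAV_incl (subtree_subset_ball g (g.length + M)) w'
    refine ⟨β, fun c => ?_, h2.trans ?_⟩
    · rw [← h1, ← locAV_incl (below_mono (Nat.le_add_right g.length M)) c]
      rw [← e2, ← hw', ← map_mul_locAV_map hφ, ← e1]
    · rw [← e2, ← hw']
      refine (norm_gns_map_le hφ hΦ _ _).trans_eq ?_
      rw [← e1]

theorem exists_site_of_shift (hφ : IsQuantumMarkovState φo E h φ) (hF : LocalizedBy E F)
    (hΦ : ∀ a b, ⟪Φ a, Φ b⟫_ℂ = φ (star a * b)) (g : Vertex k) (M : ℕ)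
    (b : Alg d (ball k M)) :
    ∃ β, (∀ c : Alg d (below k g.length),
      φ (locAV _ c * shift g (locAV _ b)) = φ (locAV _ c * site g β)) ∧
      ‖Φ (site g β)‖ ≤ ‖Φ (shift g (locAV _ b))‖ := by
  let e : ball k M ≃ subtree g (g.length + M) :=
    { toFun x := ⟨g ++ x, mem_subtree.2 ⟨by
        have := mem_below.1 x.2
        rw [List.length_append]
        omega, List.prefix_append g x⟩⟩
      invFun y := ⟨y.1.drop g.length, mem_below.2 (by
        have := (mem_subtree.1 y.2).1
        rw [List.length_drop]
        omega)⟩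
      left_inv x := Subtype.ext (List.drop_left ..)
      right_inv y := Subtype.ext (List.prefix_iff_eq_append.1 (mem_subtree.1 y.2).2) }
  rw [shift_locAV g e (fun _ => rfl) b]
  exact exists_site_of_subtree hφ hF hΦ g M _

/-- Conditioning an observable `q` at a successor of `x` on the site `x`. The observable `t` is the
orthogonal projection of `q` to the fixed points of the transition expectation at `x`. -/
theorem exists_site_of_succ (hd : 1 ≤ d) (hφ : IsQuantumMarkovState φo E h φ)
    (hF : LocalizedBy E F) (hΦi : Function.Injective Φ)
    (hΦ : ∀ a b, ⟪Φ a, Φ b⟫_ℂ = φ (star a * b)) (x : Vertex k) (j : Fin k)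
    (q : Matrix (Fin d) (Fin d) ℂ) :
    ∃ t, (∀ c : Alg d (below k x.length),
      φ (locAV _ c * site (x ++ [j]) q) = φ (locAV _ c * site x t)) ∧
      ⟪Φ (site x t), Φ (site (x ++ [j]) q)⟫_ℂ = (‖Φ (site x t)‖ : ℂ) ^ 2 := by
  have hx : x ∈ level k x.length := mem_level.2 rfl
  have hsub : {x} ⊆ insert x (succs x) := by simp
  have hsub' : {x ++ [j]} ⊆ insert x (succs x) :=
    Finset.singleton_subset_iff.2 (mem_star.2 (Or.inr ⟨j, rfl⟩))
  let i : Alg d (insert x (succs x)) →ₗ[ℂ] H :=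
    Φ ∘ₗ (locAV (d := d) (insert x (succs x))).toAlgHom.toLinearMap
  let f : Alg d (insert x (succs x)) →ₗ[ℂ] Alg d (insert x (succs x)) :=
    inclₗ hsub ∘ₗ (F x).toLinearMap
  have hE : ∀ w : Alg d (insert x (succs x)), locAV _ (f w) =
      locAV _ (E x.length (incl (star_subset_ball hx) w)) := fun w => by
    rw [hF.map_incl_star hx, locAV_incl]
    exact locAV_incl hsub (F x w)
  have hcontr : ∀ w, ‖i (f w)‖ ≤ ‖i w‖ := fun w => by
    change ‖Φ (locAV _ (f w))‖ ≤ ‖Φ (locAV _ w)‖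
    rw [hE, ← locAV_incl (star_subset_ball hx) w]
    exact norm_gns_map_le hφ hΦ _ _
  obtain ⟨q', hq'⟩ : ∃ q' : Alg d (insert x (succs x)), locAV _ q' = site (x ++ [j]) q :=
    ⟨incl hsub' _, locAV_incl hsub' _⟩
  have : FiniteDimensional ℂ (Alg d (insert x (succs x))) :=
    inferInstanceAs (FiniteDimensional ℂ (Matrix _ _ ℂ))
  obtain ⟨p, r, hp, hq, hin⟩ :=
    exists_fixed_add_coboundary i (hΦi.comp (locAV_injective hd _)) f hcontr q'
  have hpt : locAV _ p = site x (siteMatrix x (F x p)) := by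
    rw [← locAV_singleton, ← locAV_incl hsub]
    exact congrArg _ hp.symm
  refine ⟨siteMatrix x (F x p), fun c => ?_, ?_⟩
  · have hr : φ (locAV _ c * locAV _ r) = φ (locAV _ c * locAV _ (f r)) := by
      rw [hE, ← map_mul_locAV_map hφ, locAV_incl]
    rw [← hq', hq, map_add, map_sub, mul_add, mul_sub, map_add, map_sub, hr, sub_self, add_zero,
      hpt]
  · rw [← hpt, ← hq']
    exact hin

theorem norm_gns_shift (hΦ : ∀ a b, ⟪Φ a, Φ b⟫_ℂ = φ (star a * b))
    (hinv : IsTranslationInvariant φ) (g : Vertex k) (a : AV k d) : ‖Φ (shift g a)‖ = ‖Φ a‖ := by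
  rw [← sq_eq_sq₀ (norm_nonneg _) (norm_nonneg _), norm_sq_gns hΦ, norm_sq_gns hΦ, ← map_star,
    ← map_mul, hinv.map_shift]

/-- Observables at distinct sites that agree are scalar. -/
theorem eq_smul_one_of_site_eq_site (hd : 1 ≤ d) {x y : Vertex k} (hxy : x ≠ y)
    {p q : Matrix (Fin d) (Fin d) ℂ} (hpq : site x p = site y q) : ∃ c : ℂ, p = c • 1 := by
  have hx : {x} ⊆ ({x, y} : Finset (Vertex k)) := by simp
  have hy : {y} ⊆ ({x, y} : Finset (Vertex k)) := by simp
  obtain ⟨p', hp', hpe⟩ : ∃ p' : Alg d {x}, locAV _ p' = site x p ∧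
      ∀ σ τ, p' σ τ = p (σ ⟨x, by simp⟩) (τ ⟨x, by simp⟩) := ⟨_, rfl, fun _ _ => rfl⟩
  obtain ⟨q', hq', hqe⟩ : ∃ q' : Alg d {y}, locAV _ q' = site y q ∧
      ∀ σ τ, q' σ τ = q (σ ⟨y, by simp⟩) (τ ⟨y, by simp⟩) := ⟨_, rfl, fun _ _ => rfl⟩
  have heq : incl hx p' = incl hy q' := by
    apply locAV_injective hd
    rw [locAV_incl, locAV_incl, hp', hq', hpq]
  let o : Fin d := ⟨0, hd⟩
  refine ⟨q o o, ?_⟩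
  ext a b
  -- Compare the entries at configurations that differ at the site `x` only.
  let s : Fin d → ({x, y} : Finset (Vertex k)) → Fin d := fun a z => if z.1 = x then a else o
  have hs := congrArg (fun A => A (s a) (s b)) heq
  simp only [incl_apply, hpe, hqe] at hs
  rw [if_pos (fun z hz => by simp [s, Finset.mem_singleton.not.1 hz])] at hs
  have e1 : ∀ a, Finset.restrict₂ (π := fun _ => Fin d) hx (s a) ⟨x, by simp⟩ = a := fun a =>
    if_pos rfl
  have e2 : ∀ a, Finset.restrict₂ (π := fun _ => Fin d) hy (s a) ⟨y, by simp⟩ = o := fun a =>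
    if_neg hxy.symm
  rw [e1, e1, e2, e2] at hs
  rw [hs, Matrix.smul_apply, Matrix.one_apply, smul_eq_mul, mul_ite, mul_one, mul_zero]
  refine if_congr ⟨fun hz => ?_, ?_⟩ rfl rfl
  · have := hz ⟨x, by simp⟩ (by simpa using hxy)
    simpa [s] using this
  · rintro rfl z _
    rfl

/-- Centred observables at neighbouring sites have correlation coefficient at most `C < 1`: by
faithfulness the two spaces of centred observables meet trivially, and by translation invariance
only finitely many pairs of sites matter. -/
theorem exists_correlation_le (hk : 1 ≤ k) (hd : 1 ≤ d) (hφ : φ 1 = 1)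
    (hinv : IsTranslationInvariant φ) (hΦi : Function.Injective Φ)
    (hΦ : ∀ a b, ⟪Φ a, Φ b⟫_ℂ = φ (star a * b)) :
    ∃ C : ℝ, 0 ≤ C ∧ C < 1 ∧ ∀ (x : Vertex k) (j : Fin k) (p q : Matrix (Fin d) (Fin d) ℂ),
      φ (site x p) = 0 → φ (site (x ++ [j]) q) = 0 →
      ‖⟪Φ (site x p), Φ (site (x ++ [j]) q)⟫_ℂ‖ ≤
        C * (‖Φ (site x p)‖ * ‖Φ (site (x ++ [j]) q)‖) := by
  let K : Vertex k → Submodule ℂ H := fun x =>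
    (LinearMap.ker (φ ∘ₗ site (d := d) x)).map (Φ ∘ₗ site x)
  have hK : ∀ j : Fin k, Disjoint (K []) (K [j]) := by
    intro j
    rw [Submodule.disjoint_def]
    rintro u ⟨p, hp, rfl⟩ ⟨q, hq, hqp⟩
    obtain ⟨c, rfl⟩ := eq_smul_one_of_site_eq_site hd (List.cons_ne_nil j []).symm (hΦi hqp).symm
    have hc : c = 0 := by
      have : φ (site [] (c • (1 : Matrix (Fin d) (Fin d) ℂ))) = 0 := hp
      rwa [map_smul, site_one, map_smul, hφ, smul_eq_mul, mul_one] at this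
    rw [hc, zero_smul, map_zero]
  choose C hC0 hC1 hC using fun j => exists_norm_inner_le_of_disjoint (K []) (K [j]) (hK j)
  have : Nonempty (Fin k) := ⟨⟨0, hk⟩⟩
  obtain ⟨j₀, hj₀⟩ := Finite.exists_max C
  refine ⟨C j₀, hC0 _, hC1 _, fun x j p q hp hq => ?_⟩
  have ep : site x p = shift x (site [] p) := by rw [shift_site, List.append_nil]
  have eq : site (x ++ [j]) q = shift x (site [j] q) := by rw [shift_site]
  rw [ep, hinv.map_shift] at hp
  rw [eq, hinv.map_shift] at hq
  rw [hΦ, ep, eq, norm_gns_shift hΦ hinv, norm_gns_shift hΦ hinv, ← map_star, ← map_mul,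
    hinv.map_shift, ← hΦ]
  exact (hC j _ ⟨p, hp, rfl⟩ _ ⟨q, hq, rfl⟩).trans
    (mul_le_mul_of_nonneg_right (hj₀ j) (by positivity))

/-- Iterated conditioning along a path decreases the norm of a centred observable
exponentially. -/
theorem exists_site_of_path (hd : 1 ≤ d) (hφ : IsQuantumMarkovState φo E h φ)
    (hF : LocalizedBy E F) (hΦi : Function.Injective Φ)
    (hΦ : ∀ a b, ⟪Φ a, Φ b⟫_ℂ = φ (star a * b)) {C : ℝ} (hC0 : 0 ≤ C)
    (hC : ∀ (x : Vertex k) (j : Fin k) (p q : Matrix (Fin d) (Fin d) ℂ),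
      φ (site x p) = 0 → φ (site (x ++ [j]) q) = 0 →
      ‖⟪Φ (site x p), Φ (site (x ++ [j]) q)⟫_ℂ‖ ≤
        C * (‖Φ (site x p)‖ * ‖Φ (site (x ++ [j]) q)‖)) (y l : Vertex k) :
    ∀ q : Matrix (Fin d) (Fin d) ℂ, φ (site (y ++ l) q) = 0 →
    ∃ t, (∀ c : Alg d (below k y.length),
      φ (locAV _ c * site (y ++ l) q) = φ (locAV _ c * site y t)) ∧
      ‖Φ (site y t)‖ ≤ C ^ l.length * ‖Φ (site (y ++ l) q)‖ := by
  induction l using List.reverseRecOn with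
  | nil =>
    intro q _
    rw [List.append_nil]
    exact ⟨q, fun c => rfl, by simp⟩
  | append_singleton l j ih =>
    intro q hq
    rw [← List.append_assoc] at hq ⊢
    obtain ⟨t, ht1, ht2⟩ := exists_site_of_succ hd hφ hF hΦi hΦ (y ++ l) j q
    have ht0 : φ (site (y ++ l) t) = 0 := by
      have := ht1 1
      rwa [map_one, one_mul, one_mul, hq, eq_comm] at this
    have htC : ‖Φ (site (y ++ l) t)‖ ≤ C * ‖Φ (site ((y ++ l) ++ [j]) q)‖ := by
      have h1 := hC (y ++ l) j t q ht0 hq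
      rw [ht2, norm_pow, Complex.norm_real, norm_norm] at h1
      rcases (norm_nonneg (Φ (site (y ++ l) t))).eq_or_lt with h0 | h0
      · rw [← h0]; positivity
      · nlinarith
    obtain ⟨s, hs1, hs2⟩ := ih t ht0
    refine ⟨s, fun c => ?_, hs2.trans ?_⟩
    · rw [← hs1, ← locAV_incl (below_mono (n := (y ++ l).length) (by simp)) c, ht1]
    · rw [List.length_append, List.length_singleton, pow_succ, mul_assoc]
      gcongr

/-- Exponential decay of the correlations of local observables. -/
theorem norm_map_mul_shift_le (hd : 1 ≤ d) (hφ : IsQuantumMarkovState φo E h φ)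
    (hF : LocalizedBy E F) (hinv : IsTranslationInvariant φ) (hΦi : Function.Injective Φ)
    (hΦ : ∀ a b, ⟪Φ a, Φ b⟫_ℂ = φ (star a * b)) {C : ℝ} (hC0 : 0 ≤ C)
    (hC : ∀ (x : Vertex k) (j : Fin k) (p q : Matrix (Fin d) (Fin d) ℂ),
      φ (site x p) = 0 → φ (site (x ++ [j]) q) = 0 →
      ‖⟪Φ (site x p), Φ (site (x ++ [j]) q)⟫_ℂ‖ ≤
        C * (‖Φ (site x p)‖ * ‖Φ (site (x ++ [j]) q)‖))
    {m M : ℕ} (a : Alg d (ball k m)) (b : Alg d (ball k M)) (hb : φ (locAV _ b) = 0)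
    (g : Vertex k) (hg : m + 1 ≤ g.length) :
    ‖φ (locAV _ a * shift g (locAV _ b))‖ ≤
      ‖Φ (star (locAV _ a))‖ * (C ^ (g.length - (m + 1)) * ‖Φ (locAV _ b)‖) := by
  obtain ⟨y, l, rfl, hy⟩ : ∃ y l, y ++ l = g ∧ y.length = m + 1 :=
    ⟨g.take (m + 1), g.drop (m + 1), List.take_append_drop _ _, by simpa using hg⟩
  obtain ⟨β, hβ1, hβ2⟩ := exists_site_of_shift hφ hF hΦ (y ++ l) M b
  have hβ0 : φ (site (y ++ l) β) = 0 := by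
    have := hβ1 1
    rwa [map_one, one_mul, one_mul, hinv.map_shift, hb, eq_comm] at this
  obtain ⟨t, ht1, ht2⟩ := exists_site_of_path hd hφ hF hΦi hΦ hC0 hC y l β hβ0
  have hsub : ball k m ⊆ below k y.length := below_mono hy.ge
  have e : φ (locAV _ a * shift (y ++ l) (locAV _ b)) = ⟪Φ (star (locAV _ a)), Φ (site y t)⟫_ℂ := by
    rw [hΦ, star_star, ← locAV_incl hsub a, ← ht1,
      ← locAV_incl (below_mono (n := (y ++ l).length) (by simp)) (incl hsub a), hβ1]
  rw [e]
  refine (norm_inner_le_norm _ _).trans (mul_le_mul_of_nonneg_left (ht2.trans ?_) (norm_nonneg _))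
  rw [norm_gns_shift hΦ hinv] at hβ2
  rw [List.length_append, hy, Nat.add_sub_cancel_left]
  gcongr

end Correlations

/-! ### The quasi-local algebra -/

section QuasiLocal

variable {k d : ℕ}

theorem exists_norm_sub_locAV_lt (a : AV k d) {ε : ℝ} (hε : 0 < ε) :
    ∃ (n : ℕ) (a' : Alg d (ball k n)), ‖a - locAV _ a'‖ < ε := by
  have hdir : Directed (· ≤ ·) fun n => (locRep (d := d) (ball k n)).range := by
    refine Monotone.directed_le fun m n hmn => ?_
    rintro _ ⟨b, rfl⟩
    exact ⟨incl (below_mono (Nat.succ_le_succ hmn)) b, locRep_incl _ b⟩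
  have ha : AV.toOp a ∈ closure
      ((⨆ n, (locRep (d := d) (ball k n)).range : StarSubalgebra ℂ _) : Set _) := by
    rw [← StarSubalgebra.topologicalClosure_coe]
    exact a.2
  obtain ⟨T, hT, hTε⟩ := Metric.mem_closure_iff.1 ha ε hε
  rw [StarSubalgebra.coe_iSup_of_directed hdir, Set.mem_iUnion] at hT
  obtain ⟨n, a', rfl⟩ := hT
  rw [dist_eq_norm] at hTε
  exact ⟨n, a', hTε⟩

/-- States are contractive. -/
theorem IsState.norm_apply_le {A : Type*} [CStarAlgebra A] {φ : A →ₗ[ℂ] ℂ} (hφ : IsState φ)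
    {H : Type*} [NormedAddCommGroup H] [InnerProductSpace ℂ H] {Φ : A →ₗ[ℂ] H}
    (hΦ : ∀ a b, ⟪Φ a, Φ b⟫_ℂ = φ (star a * b)) (a : A) : ‖φ a‖ ≤ ‖a‖ := by
  have hnorm : ∀ a : A, ‖Φ a‖ ≤ ‖a‖ := by
    intro a
    let _ : PartialOrder A := CStarAlgebra.spectralOrder A
    let _ : StarOrderedRing A := CStarAlgebra.spectralOrderedRing A
    obtain ⟨w, hw⟩ := CStarAlgebra.nonneg_iff_eq_star_mul_self.1
      (sub_nonneg.2 (CStarAlgebra.star_mul_le_algebraMap_norm_sq (a := a)))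
    have h := hφ.nonneg w
    have e : algebraMap ℝ A (‖a‖ ^ 2) = ((‖a‖ ^ 2 : ℝ) : ℂ) • (1 : A) := by
      rw [Algebra.algebraMap_eq_smul_one]
      exact (Complex.coe_smul _ _).symm
    rw [← hw, map_sub, e, map_smul, hφ.map_one, smul_eq_mul, mul_one, sub_nonneg] at h
    rw [← sq_le_sq₀ (norm_nonneg _) (norm_nonneg _), norm_sq_gns hΦ]
    exact (Complex.le_def.1 h).1
  have h1 : ‖Φ 1‖ = 1 := by
    have : ‖Φ 1‖ ^ 2 = 1 := by
      rw [norm_sq_gns hΦ, star_one, one_mul, hφ.map_one, Complex.one_re]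
    nlinarith [norm_nonneg (Φ 1)]
  have e : φ a = ⟪Φ 1, Φ a⟫_ℂ := by rw [hΦ, star_one, one_mul]
  rw [e]
  refine (norm_inner_le_norm _ _).trans ?_
  rw [h1, one_mul]
  exact hnorm a

end QuasiLocal

/-! ### Strong mixing -/

open Filter Topology in
theorem IsLocalizedQMS.isStronglyMixing {k d : ℕ} (hk : 1 ≤ k) (hd : 1 ≤ d) {φ : AV k d →ₗ[ℂ] ℂ}
    (hφ : IsLocalizedQMS φ) (hinv : IsTranslationInvariant φ) (hfaith : IsFaithful φ) :
    IsStronglyMixing φ := by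
  obtain ⟨φo, E, h, hQ, F, hF1, hF2⟩ := hφ
  have hF : LocalizedBy E F := ⟨hF1, hF2⟩
  obtain ⟨H, _, _, Φ, hΦi, hΦ⟩ := hQ.state.exists_gns hfaith
  have hone := hQ.state.map_one
  obtain ⟨C, hC0, hC1, hC⟩ := exists_correlation_le hk hd hone hinv hΦi hΦ
  have hnorm : ∀ a, ‖φ a‖ ≤ ‖a‖ := hQ.state.norm_apply_le hΦ
  -- The covariance of `a` and `α_g(b)` is bilinear and bounded in `a` and `b`, uniformly in `g`.
  let D : AV k d → AV k d → Vertex k → ℂ := fun a b g => φ (a * shift g b) - φ a * φ b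
  have hD : ∀ a b g, ‖D a b g‖ ≤ 2 * (‖a‖ * ‖b‖) := by
    intro a b g
    have h1 : ‖φ (a * shift g b)‖ ≤ ‖a‖ * ‖b‖ := (hnorm _).trans <| (norm_mul_le _ _).trans <|
      mul_le_mul_of_nonneg_left (NonUnitalStarAlgHom.norm_apply_le (shift g) b) (norm_nonneg a)
    have h2 : ‖φ a * φ b‖ ≤ ‖a‖ * ‖b‖ := by
      rw [norm_mul]
      exact mul_le_mul (hnorm a) (hnorm b) (norm_nonneg _) (norm_nonneg _)
    exact (norm_sub_le _ _).trans (by linarith)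
  have hloc : ∀ (m M : ℕ) (a : Alg d (ball k m)) (b : Alg d (ball k M)),
      Tendsto (D (locAV _ a) (locAV _ b)) (comap List.length atTop) (𝓝 0) := by
    intro m M a b
    -- Centring `b` turns the covariance into a correlation.
    let b₀ : Alg d (ball k M) := b - φ (locAV _ b) • 1
    have hb₀ : locAV _ b₀ = locAV _ b - φ (locAV _ b) • 1 := by
      rw [map_sub, map_smul, map_one]
    have hDb : ∀ g, D (locAV _ a) (locAV _ b) g = φ (locAV _ a * shift g (locAV _ b₀)) := by
      intro g
      rw [hb₀, map_sub, map_smul, map_one, mul_sub, map_sub, mul_smul_comm, mul_one, map_smul,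
        smul_eq_mul, mul_comm (φ _)]
    have hpow : Tendsto (fun n : ℕ => ‖Φ (star (locAV _ a))‖ *
        (C ^ (n - (m + 1)) * ‖Φ (locAV _ b₀)‖)) atTop (𝓝 0) := by
      have := (((tendsto_pow_atTop_nhds_zero_of_lt_one hC0 hC1).comp
        (tendsto_sub_atTop_nat (m + 1))).mul_const ‖Φ (locAV _ b₀)‖).const_mul
          ‖Φ (star (locAV _ a))‖
      simpa using this
    refine squeeze_zero_norm' ?_ (hpow.comp tendsto_comap)
    filter_upwards [tendsto_comap.eventually (eventually_ge_atTop (m + 1))] with g hg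
    rw [hDb]
    refine norm_map_mul_shift_le hd hQ hF hinv hΦi hΦ hC0 hC a b₀ ?_ g hg
    rw [hb₀, map_sub, map_smul, hone, smul_eq_mul, mul_one, sub_self]
  intro a b
  rw [← tendsto_sub_nhds_zero_iff]
  change Tendsto (D a b) _ _
  rw [Metric.tendsto_nhds]
  intro ε hε
  obtain ⟨m, a', ha'⟩ := exists_norm_sub_locAV_lt a (ε := ε / (6 * (‖b‖ + 1))) (by positivity)
  obtain ⟨M, b', hb'⟩ := exists_norm_sub_locAV_lt b (ε := ε / (6 * (‖locAV _ a'‖ + 1)))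
    (by positivity)
  filter_upwards [Metric.tendsto_nhds.1 (hloc m M a' b') (ε / 3) (by positivity)] with g hg
  rw [dist_zero_right] at hg ⊢
  have hsplit : D a b g = D (a - locAV _ a') b g + D (locAV _ a') (b - locAV _ b') g +
      D (locAV _ a') (locAV _ b') g := by
    simp only [D, map_sub, sub_mul, mul_sub]
    ring
  have h1 : 2 * (‖a - locAV _ a'‖ * ‖b‖) ≤ ε / 3 := by
    rw [lt_div_iff₀ (by positivity)] at ha'
    nlinarith [norm_nonneg (a - locAV _ a')]
  have h2 : 2 * (‖locAV _ a'‖ * ‖b - locAV _ b'‖) ≤ ε / 3 := by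
    rw [lt_div_iff₀ (by positivity)] at hb'
    nlinarith [norm_nonneg (b - locAV _ b')]
  rw [hsplit]
  calc _ ≤ ‖D (a - locAV _ a') b g‖ + ‖D (locAV _ a') (b - locAV _ b') g‖ +
        ‖D (locAV _ a') (locAV _ b') g‖ := norm_add₃_le
    _ < ε := by linarith [hD (a - locAV _ a') b g, hD (locAV _ a') (b - locAV _ b') g]

end TreeQMS

theorem mainTheorem4 (k d : ℕ) (hk : 1 ≤ k) (hd : 1 ≤ d) (φ : AV k d →ₗ[ℂ] ℂ)
    (hφ : IsLocalizedQMS φ) (hinv : IsTranslationInvariant φ) (hfaith : IsFaithful φ) :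
    IsStronglyMixing φ :=
  hφ.isStronglyMixing hk hd hinv hfaith
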